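/- Let $\Bbbk$ be a field of characteristic $0$. A symmetric $I$-coloured collection $\mathcal P$ over $\Bbbk$ assigns a vector space $\mathcal P(X,\chi,c)$ to each finite set $X$ of inputs with a colouring $\chi\colon X\to I$ and each output colour $c\in I$, contravariantly functorial in colour-preserving bijections; an isomorphism of collections is a family of linear isomorphisms compatible with these relabellings (in particular, with the actions of the symmetric groups). Consider two colours $1$ and $2$. Let $\mathrm{MLie}$ be the symmetric $2$-coloured operad over $\Bbbk$ whose algebras are pairs of a Lie algebra (of colour $2$) and a module over it (of colour $1$). That is, $\mathrm{MLie}$ is generated by a binary operation $\beta$ with both inputs and the output of colour $2$ and a binary operation $d$ with first input of colour $2$, second input of colour $1$ and output of colour $1$, subject to $$\beta(x_1,x_2)=-\beta(x_2,x_1),\qquad \beta(\beta(x_1,x_2),x_3)-\beta(\beta(x_1,x_3),x_2)-\beta(x_1,\beta(x_2,x_3))=0,$$ $$d(\beta(x_1,x_2),x_3)-d(x_1,d(x_2,x_3))+d(x_2,d(x_1,x_3))=0 .$$ Let $\mathcal F(d)$ be the free symmetric $2$-coloured operad on the single generator $d$ (with the same colours, and no symmetry), and let $\mathrm{Lie}$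 be the (uncoloured) operad of Lie algebras. Let $(\mathcal F(d),\mathrm{Lie})$ be the $2$-coloured collection whose component with output colour $1$ is $\mathcal F(d)(X,\chi,1)$, and whose component with output colour $2$ is $\mathrm{Lie}(X)$ if all inputs have colour $2$, and $0$ otherwise. Then there is an isomorphism of symmetric coloured collections $$\mathrm{MLie}\simeq(\mathcal F(d),\mathrm{Lie}).$$ Moreover, all spaces $\mathrm{MLie}(X,\chi,c)$ are finite-dimensional, and the generating series $$F^{c}(t_1,t_2)=\sum_{m_1,m_2\ge 0}\frac{\dim \mathrm{MLie}(m_1+m_2,\chi,c)}{m_1!\,m_2!}\,t_1^{m_1}t_2^{m_2},\qquad |\chi^{-1}(j)|=m_j,\quad c\in\{1,2\},$$ are the formal power series $$\bigl(F^1,F^2\bigr)=\left(\frac{t_1}{1-t_2},\ -\log(1-t_2)\right).$$ -/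

import Mathlib

universe u

namespace ColOp

/-! ### Symmetric coloured collections -/

/-- A symmetric `I`-coloured collection over `k`. To a finite set `X` of inputs with colouring
`χ : X → I` and to an output colour `c` it assigns a `k`-module `obj X χ c`, contravariantly
functorial for colour-preserving bijections. For `X = Fin n` and `e` a permutation, `res` is the
right action `P(n, χ, c) → P(n, χσ, c)` of the symmetric group. -/
structure ColouredCollection (k : Type u) [Field k] (I : Type) where
  obj : ∀ (X : Type) [Finite X] (_ : X → I) (_ : I), ModuleCat.{u} k
  res : ∀ {X Y : Type} [Finite X] [Finite Y] (e : X ≃ Y) (χ : Y → I) (c : I),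
    obj Y χ c →ₗ[k] obj X (χ ∘ e) c
  res_refl : ∀ {X : Type} [Finite X] (χ : X → I) (c : I),
    res (Equiv.refl X) χ c = LinearMap.id
  res_trans : ∀ {X Y Z : Type} [Finite X] [Finite Y] [Finite Z] (e : X ≃ Y) (f : Y ≃ Z)
    (χ : Z → I) (c : I), res (e.trans f) χ c = res e (χ ∘ f) c ∘ₗ res f χ c

/-- Isomorphism of symmetric coloured collections: linear isomorphisms of all components that
commute with the relabelling of inputs (in particular with the symmetric group actions). -/
structure ColouredCollection.Iso {k : Type u} [Field k] {I : Type}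
    (P Q : ColouredCollection k I) where
  equiv : ∀ (X : Type) [Finite X] (χ : X → I) (c : I), P.obj X χ c ≃ₗ[k] Q.obj X χ c
  natural : ∀ {X Y : Type} [Finite X] [Finite Y] (e : X ≃ Y) (χ : Y → I) (c : I)
    (p : P.obj Y χ c), equiv X (χ ∘ e) c (P.res e χ c p) = Q.res e χ c (equiv Y χ c p)

/-- All spaces of operations of the collection are finite-dimensional. -/
def ColouredCollection.FiniteDim {k : Type u} [Field k] {I : Type}
    (P : ColouredCollection k I) : Prop :=
  ∀ (X : Type) [Finite X] (χ : X → I) (c : I), FiniteDimensional k (P.obj X χ c)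

/-- The component of output colour `c` of the generating series of a coloured collection: the
coefficient of `∏ tᵢ ^ mᵢ` is `dim P(∑ mᵢ, χ, c) / ∏ mᵢ!`, where `χ` takes every value `i`
exactly `mᵢ` times. -/
noncomputable def ColouredCollection.genSeries {k : Type u} [Field k] {I : Type} [Fintype I]
    (P : ColouredCollection k I) (c : I) : MvPowerSeries I ℚ :=
  fun m => (Module.finrank k (P.obj (Σ i, Fin (m i)) Sigma.fst c) : ℚ) /
    ∏ i, ((m i).factorial : ℚ)

/-! ### Tree monomials -/

/-- A set of binary generating operations with colours of the first input, of the second input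
and of the output. -/
structure BinarySignature (I : Type) where
  Gen : Type
  in₁ : Gen → I
  in₂ : Gen → I
  out : Gen → I

/-- Planar coloured rooted trees with output colour `c`, whose vertices are marked by generators
and whose leaves are marked by elements of the coloured set `(X, χ)`. The tree `leaf x h` is the
degenerate tree. -/
inductive CTree {I : Type} (S : BinarySignature I) {X : Type} (χ : X → I) : I → Type
  | leaf {c : I} (x : X) (h : χ x = c) : CTree S χ c
  | node {c : I} (g : S.Gen) (h : S.out g = c) (l : CTree S χ (S.in₁ g))
      (r : CTree S χ (S.in₂ g)) : CTree S χ c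

section Trees

variable {I : Type} {S : BinarySignature I} {X Y : Type} {χ : X → I} {χ' : Y → I} {c : I}

/-- The list of leaf labels, from left to right. -/
def CTree.leaves {I : Type} {S : BinarySignature I} {X : Type} {χ : X → I} :
    {c : I} → CTree S χ c → List X
  | _, .leaf x _ => [x]
  | _, .node _ _ l r => l.leaves ++ r.leaves

/-- Substitution of trees for the leaves. -/
def CTree.bind {I : Type} {S : BinarySignature I} {X Y : Type} {χ : X → I} {χ' : Y → I}
    (f : ∀ (x : X) (c : I), χ x = c → CTree S χ' c) : {c : I} → CTree S χ c → CTree S χ' c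
  | _, .leaf x h => f x _ h
  | _, .node g h l r => .node g h (l.bind f) (r.bind f)

theorem CTree.leaves_bind (f : ∀ (x : X) (c : I), χ x = c → CTree S χ' c) (t : CTree S χ c) :
    (t.bind f).leaves = t.leaves.flatMap (fun x => (f x _ rfl).leaves) := by
  induction t with
  | leaf x h => subst h; simp [CTree.bind, CTree.leaves]
  | node g h l r ihl ihr => simp [CTree.bind, CTree.leaves, ihl, ihr]

theorem CTree.bind_bind {Z : Type} {χ'' : Z → I} (f : ∀ (x : X) (c : I), χ x = c → CTree S χ' c)
    (g : ∀ (y : Y) (c : I), χ' y = c → CTree S χ'' c) (t : CTree S χ c) :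
    (t.bind f).bind g = t.bind (fun x c h => (f x c h).bind g) := by
  induction t with
  | leaf x h => rfl
  | node a h l r ihl ihr => simp [CTree.bind, ihl, ihr]

theorem CTree.bind_leaf (t : CTree S χ c) : t.bind (fun x _ h => .leaf x h) = t := by
  induction t with
  | leaf x h => rfl
  | node a h l r ihl ihr => simp [CTree.bind, ihl, ihr]

/-- Relabelling of the leaves along a colour-preserving map. -/
def CTree.map (f : X → Y) (hf : ∀ x, χ' (f x) = χ x) (t : CTree S χ c) : CTree S χ' c :=
  t.bind (fun x _ h => .leaf (f x) ((hf x).trans h))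

theorem CTree.leaves_map (f : X → Y) (hf : ∀ x, χ' (f x) = χ x) (t : CTree S χ c) :
    (t.map f hf).leaves = t.leaves.map f := by
  rw [CTree.map, CTree.leaves_bind]
  simp only [CTree.leaves]
  exact List.flatMap_pure_eq_map _ _

theorem CTree.map_map {Z : Type} {χ'' : Z → I} (f : X → Y) (hf : ∀ x, χ' (f x) = χ x)
    (g : Y → Z) (hg : ∀ y, χ'' (g y) = χ' y) (t : CTree S χ c) :
    (t.map f hf).map g hg
      = t.map (χ' := χ'') (fun x => g (f x)) (fun x => (hg _).trans (hf x)) :=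
  CTree.bind_bind _ _ t

/-- Every label marks exactly one leaf. -/
def CTree.IsLinear (t : CTree S χ c) : Prop := t.leaves.Nodup ∧ ∀ x, x ∈ t.leaves

instance [Fintype X] [DecidableEq X] (t : CTree S χ c) : Decidable t.IsLinear :=
  inferInstanceAs (Decidable (t.leaves.Nodup ∧ ∀ x, x ∈ t.leaves))

end Trees

/-- Tree monomials: trees whose leaves are bijectively marked by the elements of `X`. -/
def TreeMonomial {I : Type} (S : BinarySignature I) {X : Type} (χ : X → I) (c : I) : Type :=
  {t : CTree S χ c // t.IsLinear}

/-- The coloured set of inputs of a partial composition at the input `x`: the input `x` of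
`(X, χ)` is replaced by the coloured set `(Y, χ')`. -/
def graftColour {I X Y : Type} (χ : X → I) (χ' : Y → I) (x : X) :
    {z : X // z ≠ x} ⊕ Y → I :=
  Sum.elim (fun z => χ z.1) χ'

section Monomials

variable {I : Type} {S : BinarySignature I} {X Y : Type} {χ : X → I} {χ' : Y → I} {c : I}

/-- The action of a bijection `e : X ≃ Y` on tree monomials: the leaf marked by `e x` gets the
label `x`. -/
def TreeMonomial.res (e : X ≃ Y) (χ : Y → I) (t : TreeMonomial S χ c) :
    TreeMonomial S (χ ∘ e) c :=
  ⟨t.1.map e.symm (fun y => by simp), by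
    rw [CTree.IsLinear, CTree.leaves_map]
    refine ⟨t.2.1.map e.symm.injective, fun x => ?_⟩
    exact List.mem_map.2 ⟨e x, t.2.2 _, by simp⟩⟩

open Classical in
/-- Grafting of the tree `s` on the leaves of `t` marked by `x`. -/
noncomputable def CTree.graft (t : CTree S χ c) (x : X) (s : CTree S χ' (χ x)) :
    CTree S (graftColour χ χ' x) c :=
  t.bind (fun z c' h =>
    if hz : z = x then
      (show χ x = c' from hz ▸ h) ▸
        s.map (χ' := graftColour χ χ' x) Sum.inr (fun _ => rfl)
    else .leaf (Sum.inl ⟨z, hz⟩) h)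

open Classical in
theorem CTree.leaves_graft (t : CTree S χ c) (x : X) (s : CTree S χ' (χ x)) :
    (t.graft x s).leaves = t.leaves.flatMap (fun z =>
      if hz : z = x then s.leaves.map Sum.inr else [Sum.inl ⟨z, hz⟩]) := by
  rw [CTree.graft, CTree.leaves_bind]
  congr 1
  funext z
  by_cases hz : z = x
  · subst hz
    rw [dif_pos rfl, dif_pos rfl]
    exact CTree.leaves_map (χ' := graftColour χ χ' z) Sum.inr (fun _ => rfl) s
  · simp [hz, CTree.leaves]

/-- Partial composition of tree monomials: grafting of `s` on the leaf of `t` marked by `x`. -/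
noncomputable def TreeMonomial.comp (t : TreeMonomial S χ c) (x : X)
    (s : TreeMonomial S χ' (χ x)) : TreeMonomial S (graftColour χ χ' x) c :=
  ⟨t.1.graft x s.1, by
    rw [CTree.IsLinear, CTree.leaves_graft]
    constructor
    · rw [List.nodup_flatMap]
      constructor
      · intro z _
        split_ifs
        · exact s.2.1.map Sum.inr_injective
        · simp
      · refine t.2.1.imp fun {a b} hab => ?_
        intro w hwa hwb
        by_cases ha : a = x
        · have hb : b ≠ x := fun hb => hab (ha.trans hb.symm)
          simp only [ha, hb, dite_true, dite_false, List.mem_map, List.mem_singleton]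
            at hwa hwb
          obtain ⟨y, _, rfl⟩ := hwa
          cases hwb
        · by_cases hb : b = x
          · simp only [ha, hb, dite_true, dite_false, List.mem_map, List.mem_singleton]
              at hwa hwb
            obtain ⟨y, _, rfl⟩ := hwb
            cases hwa
          · simp only [ha, hb, dite_false, List.mem_singleton] at hwa hwb
            rw [hwa] at hwb
            exact hab (by simpa using hwb)
    · intro w
      rw [List.mem_flatMap]
      rcases w with ⟨z, hz⟩ | y
      · exact ⟨z, t.2.2 z, by simp [hz]⟩
      · exact ⟨x, t.2.2 x, by simpa using s.2.2 y⟩⟩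

theorem TreeMonomial.res_refl (t : TreeMonomial S χ c) :
    TreeMonomial.res (Equiv.refl X) χ t = t :=
  Subtype.ext (CTree.bind_leaf t.1)

theorem TreeMonomial.res_trans {Z : Type} (e : X ≃ Y) (f : Y ≃ Z) (χ : Z → I)
    (t : TreeMonomial S χ c) :
    TreeMonomial.res (e.trans f) χ t = TreeMonomial.res e (χ ∘ f) (TreeMonomial.res f χ t) := by
  refine Subtype.ext ?_
  exact (CTree.map_map (χ' := χ ∘ f) (χ'' := (χ ∘ f) ∘ e) f.symm (fun z => by simp) e.symm
    (fun y => by simp) t.1).symm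

end Monomials

/-! ### Free coloured operads and operadic ideals -/

section Free

variable (k : Type u) [Field k] {I : Type} (S : BinarySignature I)

/-- The space of operations of the free symmetric coloured operad generated by `S`: the vector
space with basis the tree monomials. Each generator spans a free orbit of the symmetric group
`Σ₂`; symmetries of generators are to be imposed as relations. -/
abbrev FreeOp {X : Type} (χ : X → I) (c : I) : Type u := TreeMonomial S χ c →₀ k

variable {k S} {X Y : Type} {χ : X → I} {χ' : Y → I} {c : I}

/-- Relabelling of the inputs of operations of the free operad. -/
noncomputable def FreeOp.res (e : X ≃ Y) (χ : Y → I) (c : I) :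
    FreeOp k S χ c →ₗ[k] FreeOp k S (χ ∘ e) c :=
  Finsupp.lmapDomain k k (TreeMonomial.res e χ)

/-- Partial composition `p ∘ₓ q` in the free operad, extended bilinearly from the grafting of
tree monomials. -/
noncomputable def FreeOp.comp (p : FreeOp k S χ c) (x : X) (q : FreeOp k S χ' (χ x)) :
    FreeOp k S (graftColour χ χ' x) c :=
  p.sum fun t a => q.sum fun s b => Finsupp.single (t.comp x s) (a * b)

theorem FreeOp.res_refl (χ : X → I) (c : I) :
    FreeOp.res (k := k) (S := S) (Equiv.refl X) χ c = LinearMap.id := by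
  have h : TreeMonomial.res (S := S) (c := c) (Equiv.refl X) χ = id :=
    funext TreeMonomial.res_refl
  rw [FreeOp.res, h]
  exact Finsupp.lmapDomain_id k k

theorem FreeOp.res_trans {Z : Type} (e : X ≃ Y) (f : Y ≃ Z) (χ : Z → I) (c : I) :
    FreeOp.res (k := k) (S := S) (e.trans f) χ c
      = FreeOp.res e (χ ∘ f) c ∘ₗ FreeOp.res f χ c := by
  have h : TreeMonomial.res (S := S) (c := c) (e.trans f) χ
      = TreeMonomial.res e (χ ∘ f) ∘ TreeMonomial.res f χ :=
    funext (TreeMonomial.res_trans e f χ)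
  rw [FreeOp.res, h]
  exact Finsupp.lmapDomain_comp k k _ _

end Free

/-- The underlying symmetric coloured collection of the free coloured operad generated by `S`. -/
noncomputable def freeOperad (k : Type u) [Field k] {I : Type} (S : BinarySignature I) :
    ColouredCollection k I where
  obj _ _ χ c := ModuleCat.of k (FreeOp k S χ c)
  res e χ c := FreeOp.res e χ c
  res_refl χ c := FreeOp.res_refl χ c
  res_trans e f χ c := FreeOp.res_trans e f χ c

/-- Operadic ideals of the free coloured operad generated by `S`. -/
structure OperadIdeal (k : Type u) [Field k] {I : Type} (S : BinarySignature I) where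
  carrier : ∀ (X : Type) [Finite X] (χ : X → I) (c : I), Submodule k (FreeOp k S χ c)
  res_mem : ∀ {X Y : Type} [Finite X] [Finite Y] (e : X ≃ Y) (χ : Y → I) (c : I)
    (p : FreeOp k S χ c), p ∈ carrier Y χ c → FreeOp.res e χ c p ∈ carrier X (χ ∘ e) c
  comp_mem_left : ∀ {X Y : Type} [Finite X] [Finite Y] {χ : X → I} {χ' : Y → I} {c : I}
    (p : FreeOp k S χ c) (x : X) (q : FreeOp k S χ' (χ x)), p ∈ carrier X χ c →
      FreeOp.comp p x q ∈ carrier ({z : X // z ≠ x} ⊕ Y) (graftColour χ χ' x) c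
  comp_mem_right : ∀ {X Y : Type} [Finite X] [Finite Y] {χ : X → I} {χ' : Y → I} {c : I}
    (p : FreeOp k S χ c) (x : X) (q : FreeOp k S χ' (χ x)), q ∈ carrier Y χ' (χ x) →
      FreeOp.comp p x q ∈ carrier ({z : X // z ≠ x} ⊕ Y) (graftColour χ χ' x) c

section Quotient

variable {k : Type u} [Field k] {I : Type} {S : BinarySignature I}

/-- The operadic ideal generated by a family `R` of relations: the intersection of all operadic
ideals that contain `R`. -/
noncomputable def OperadIdeal.generate
    (R : ∀ (X : Type) [Finite X] (χ : X → I) (c : I), Set (FreeOp k S χ c)) :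
    OperadIdeal k S where
  carrier X _ χ c :=
    ⨅ J : {J : OperadIdeal k S // ∀ (X : Type) [Finite X] (χ : X → I) (c : I),
      R X χ c ⊆ J.carrier X χ c}, J.1.carrier X χ c
  res_mem e χ c p hp := by
    rw [Submodule.mem_iInf] at hp ⊢
    exact fun J => J.1.res_mem e χ c p (hp J)
  comp_mem_left p x q hp := by
    rw [Submodule.mem_iInf] at hp ⊢
    exact fun J => J.1.comp_mem_left p x q (hp J)
  comp_mem_right p x q hq := by
    rw [Submodule.mem_iInf] at hq ⊢
    exact fun J => J.1.comp_mem_right p x q (hq J)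

/-- The underlying symmetric coloured collection of the quotient of the free coloured operad by
an operadic ideal. -/
noncomputable def quotientOperad (J : OperadIdeal k S) : ColouredCollection k I where
  obj X _ χ c := ModuleCat.of k (FreeOp k S χ c ⧸ J.carrier X χ c)
  res e χ c :=
    Submodule.mapQ (J.carrier _ χ c) (J.carrier _ (χ ∘ e) c) (FreeOp.res e χ c)
      (fun p hp => J.res_mem e χ c p hp)
  res_refl χ c := by
    refine Submodule.linearMap_qext _ (LinearMap.ext fun p => ?_)
    exact congrArg (Submodule.Quotient.mk (p := J.carrier _ χ c))
      (LinearMap.congr_fun (FreeOp.res_refl χ c) p)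
  res_trans e f χ c := by
    refine Submodule.linearMap_qext _ (LinearMap.ext fun p => ?_)
    exact congrArg (Submodule.Quotient.mk (p := J.carrier _ (χ ∘ e.trans f) c))
      (LinearMap.congr_fun (FreeOp.res_trans e f χ c) p)

end Quotient

/-- The element of the free operad given by a tree monomial. -/
noncomputable def mono (k : Type u) [Field k] {I : Type} {S : BinarySignature I} {X : Type}
    {χ : X → I} {c : I} (t : CTree S χ c) (h : t.IsLinear) : FreeOp k S χ c :=
  Finsupp.single ⟨t, h⟩ 1

/-! ### The operad `Lie` -/

/-- The generator of the operad `Lie`. -/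
inductive LieGen
  | β

/-- The signature of `Lie`: one colour, one binary operation `β`. -/
def lieSig : BinarySignature Unit where
  Gen := LieGen
  in₁ _ := ()
  in₂ _ := ()
  out _ := ()

namespace Lie

/-- The inputs of an uncoloured operation. -/
abbrev col (X : Type) : X → Unit := fun _ => ()

/-- The degenerate tree with input `x`. -/
def inp {X : Type} (x : X) : CTree lieSig (col X) () := .leaf x rfl

/-- The operation `β(l, r)`. -/
def br {X : Type} (l r : CTree lieSig (col X) ()) : CTree lieSig (col X) () :=
  .node LieGen.β rfl l r

/-- The relations of `Lie`, with inputs numbered from `0`. -/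
inductive Rel (k : Type u) [Field k] :
    ∀ (X : Type) [Finite X] (χ : X → Unit) (c : Unit), FreeOp k lieSig χ c → Prop
  /-- Antisymmetry `β(1,2) + β(2,1)`. -/
  | antisymm : Rel k (Fin 2) (col _) ()
      (mono k (br (inp 0) (inp 1)) (by decide) + mono k (br (inp 1) (inp 0)) (by decide))
  /-- The Jacobi relation `β(β(1,2),3) - β(β(1,3),2) - β(1,β(2,3))`. -/
  | jacobi : Rel k (Fin 3) (col _) ()
      (mono k (br (br (inp 0) (inp 1)) (inp 2)) (by decide)
        - mono k (br (br (inp 0) (inp 2)) (inp 1)) (by decide)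
        - mono k (br (inp 0) (br (inp 1) (inp 2))) (by decide))

end Lie

/-- The (underlying collection of the) operad `Lie` of Lie algebras. -/
noncomputable def lieOperad (k : Type u) [Field k] : ColouredCollection k Unit :=
  quotientOperad (OperadIdeal.generate (fun X _ χ c => {p | Lie.Rel k X χ c p}))

/-! ### The operads `F(d)` and `MLie` -/

/-- The two colours: `first` is the colour of modules, `second` is the colour of Lie algebras. -/
inductive Colour
  | first
  | second
  deriving DecidableEq

instance : Fintype Colour := ⟨{.first, .second}, fun c => by cases c <;> decide⟩

/-- The generator of the operad `F(d)`. -/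
inductive DGen
  | d

/-- One binary operation `d` with inputs of the second and of the first colour (in this order)
and output of the first colour. -/
def dSig : BinarySignature Colour where
  Gen := DGen
  in₁ _ := .second
  in₂ _ := .first
  out _ := .first

/-- The (underlying collection of the) free `2`-coloured operad `F(d)`. -/
noncomputable def freeD (k : Type u) [Field k] : ColouredCollection k Colour :=
  freeOperad k dSig

/-- The generators of the operad `MLie`. -/
inductive MLieGen
  | β
  | d

/-- The operation `β` has two inputs and the output of the second colour; the operation `d` has
inputs of the second and of the first colour (in this order) and output of the first colour. -/
def mlieSig : BinarySignature Colour where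
  Gen := MLieGen
  in₁ _ := .second
  in₂
    | .β => .second
    | .d => .first
  out
    | .β => .second
    | .d => .first

namespace MLie

/-- The degenerate tree with input `x`. -/
def inp {X : Type} {χ : X → Colour} (x : X) : CTree mlieSig χ (χ x) := .leaf x rfl

/-- The operation `β(l, r)`. -/
def br {X : Type} {χ : X → Colour} (l r : CTree mlieSig χ .second) :
    CTree mlieSig χ .second :=
  .node MLieGen.β rfl l r

/-- The operation `d(l, m)`. -/
def act {X : Type} {χ : X → Colour} (l : CTree mlieSig χ .second) (m : CTree mlieSig χ .first) :
    CTree mlieSig χ .first :=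
  .node MLieGen.d rfl l m

/-- Colouring with the second colour only. -/
abbrev lieCol (n : ℕ) : Fin n → Colour := fun _ => .second

/-- The colouring of three inputs by second, second, first. -/
abbrev actCol : Fin 3 → Colour := ![.second, .second, .first]

/-- The relations of `MLie`, with inputs numbered from `0`. -/
inductive Rel (k : Type u) [Field k] :
    ∀ (X : Type) [Finite X] (χ : X → Colour) (c : Colour), FreeOp k mlieSig χ c → Prop
  /-- Antisymmetry `β(1,2) + β(2,1)`. -/
  | antisymm : Rel k (Fin 2) (lieCol 2) .second
      (mono k (br (inp 0) (inp 1)) (by decide) + mono k (br (inp 1) (inp 0)) (by decide))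
  /-- The Jacobi relation `β(β(1,2),3) - β(β(1,3),2) - β(1,β(2,3))`. -/
  | jacobi : Rel k (Fin 3) (lieCol 3) .second
      (mono k (br (br (inp 0) (inp 1)) (inp 2)) (by decide)
        - mono k (br (br (inp 0) (inp 2)) (inp 1)) (by decide)
        - mono k (br (inp 0) (br (inp 1) (inp 2))) (by decide))
  /-- The module relation `d(β(1,2),3) - d(1,d(2,3)) + d(2,d(1,3))`. -/
  | module : Rel k (Fin 3) actCol .first
      (mono k (act (br (inp 0) (inp 1)) (inp 2)) (by decide)
        - mono k (act (inp 0) (act (inp 1) (inp 2))) (by decide)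
        + mono k (act (inp 1) (act (inp 0) (inp 2))) (by decide))

end MLie

/-- The (underlying collection of the) `2`-coloured operad `MLie` of pairs of a Lie algebra and
a module over it. -/
noncomputable def mlieOperad (k : Type u) [Field k] : ColouredCollection k Colour :=
  quotientOperad (OperadIdeal.generate (fun X _ χ c => {p | MLie.Rel k X χ c p}))

/-! ### The coloured collection `(P, L)` -/

section Pair

variable {k : Type u} [Field k]

/-- The components of the coloured collection `(P, L)`. The functions on the proposition
`∀ x, χ x = .second` with values in `V` are `V` if the proposition holds and `0` if not. -/
noncomputable def pairObj (P : ColouredCollection k Colour) (L : ColouredCollection k Unit)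
    (X : Type) [Finite X] (χ : X → Colour) : Colour → ModuleCat.{u} k
  | .first => P.obj X χ .first
  | .second => ModuleCat.of k (PLift (∀ x, χ x = .second) → L.obj X (fun _ => ()) ())

/-- The relabelling maps of the coloured collection `(P, L)`. -/
noncomputable def pairRes (P : ColouredCollection k Colour) (L : ColouredCollection k Unit)
    {X Y : Type} [Finite X] [Finite Y] (e : X ≃ Y) (χ : Y → Colour) :
    ∀ c : Colour, pairObj P L Y χ c →ₗ[k] pairObj P L X (χ ∘ e) c
  | .first => P.res e χ .first
  | .second => LinearMap.pi fun h => L.res e (fun _ => ()) () ∘ₗ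
      LinearMap.proj (PLift.up fun y => by simpa using h.down (e.symm y))

/-- The coloured collection `(P, L)`: the operations with output of the first colour are those
of `P`; the operations with output of the second colour have all inputs of the second colour and
are the operations of the uncoloured collection `L`. -/
noncomputable def pairCollection (P : ColouredCollection k Colour)
    (L : ColouredCollection k Unit) : ColouredCollection k Colour where
  obj X _ χ c := pairObj P L X χ c
  res e χ c := pairRes P L e χ c
  res_refl χ c := by
    cases c with
    | first => exact P.res_refl χ .first
    | second =>
      refine LinearMap.ext fun p => funext fun h => ?_
      exact LinearMap.congr_fun (L.res_refl (fun _ => ()) ()) (p h)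
  res_trans e f χ c := by
    cases c with
    | first => exact P.res_trans e f χ .first
    | second =>
      refine LinearMap.ext fun p => funext fun h => ?_
      exact LinearMap.congr_fun (L.res_trans e f (fun _ => ()) ()) (p _)

end Pair

end ColOp

/-! Trees are evaluated in the free associative algebra on their labels, with `β` going to the
commutator and `d` to the product. A free associative algebra is a Lie algebra under the commutator
and a module over it by left multiplication, so the relations of `MLie` hold there. The kernel of
the evaluation is an operadic ideal, hence it contains the ideal of relations (`MLie.ideal_le`).

The opposite inclusion is a rewriting argument. For output of the first colour, the module relation
d([a,b],u) = d(a,d(b,u)) - d(b,d(a,u)) removes every bracket, so the trees of F(d) span. They are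
right combs and evaluate to distinct words (`dTree_leaves_injective`). For output of the second
colour, an input x is fixed; antisymmetry and Jacobi reduce every tree to left-normed brackets
starting with x. Such a bracket evaluates to one word starting with x plus words starting with other
letters, so their values are independent (`Lie.linearIndependent_commutator_leftNormed`). A spanning
family with independent values is a basis of the quotient and forces the ideal to equal the kernel
(`eq_ker_and_bijective_of_linearIndependent`).

In the first colour the isomorphism is induced by the inclusion of F(d), which commutes with
relabelling. In the second colour the left-normed basis depends on x and is not equivariant. There
the ideals of `MLie` and of `Lie` are instead both identified with the kernel of one evaluation, so
that forgetting colours is a natural isomorphism (`MLie.mem_ideal_second`).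

Operadic ideals are closed under partial composition of trees with bijectively marked leaves, which
is awkward for rewriting inside a tree. The rewriting therefore takes place among trees with
arbitrary, possibly repeated labels, modulo `OperadIdeal.rawSpan`, and `linearPart` brings the
result back into the ideal.

The dimensions come from counting: m₂! combs when m₁ = 1, and (m₂ - 1)! left-normed brackets when m₁
= 0 and m₂ > 0. -/

namespace ColOp

open Finsupp (mapDomain)

/-! ### Ideals and trees with repeated labels -/

section Raw

variable {k : Type u} [Field k] {I : Type} {S : BinarySignature I}

/-- Every tree is obtained by relabelling from a tree monomial. -/
theorem CTree.exists_linear_map {X : Type} {χ : X → I} {c : I} (t : CTree S χ c) :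
    ∃ (Z : Type) (_ : Finite Z) (χ' : Z → I) (g : Z → X) (hg : ∀ z, χ (g z) = χ' z)
      (s : TreeMonomial S χ' c), s.1.map g hg = t := by
  induction t with
  | leaf x h =>
    exact ⟨Unit, inferInstance, fun _ => χ x, fun _ => x, fun _ => rfl,
      ⟨.leaf () h, by simp [IsLinear, leaves]⟩, rfl⟩
  | node a h l r ihl ihr =>
    obtain ⟨Z, _, χ₁, g₁, hg₁, ⟨s₁, hs₁⟩, rfl⟩ := ihl
    obtain ⟨W, _, χ₂, g₂, hg₂, ⟨s₂, hs₂⟩, rfl⟩ := ihr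
    have hg : ∀ y, χ (Sum.elim g₁ g₂ y) = Sum.elim χ₁ χ₂ y := by
      rintro (z | w) <;> simp [hg₁, hg₂]
    refine ⟨Z ⊕ W, inferInstance, Sum.elim χ₁ χ₂, Sum.elim g₁ g₂, hg,
      ⟨.node a h (s₁.map (χ' := Sum.elim χ₁ χ₂) Sum.inl fun _ => rfl)
        (s₂.map (χ' := Sum.elim χ₁ χ₂) Sum.inr fun _ => rfl), ?_⟩, ?_⟩
    · have hl := congrArg₂ (· ++ ·)
        (CTree.leaves_map (χ' := Sum.elim χ₁ χ₂) Sum.inl (fun _ => rfl) s₁)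
        (CTree.leaves_map (χ' := Sum.elim χ₁ χ₂) Sum.inr (fun _ => rfl) s₂)
      refine (congrArg (fun l : List (Z ⊕ W) => l.Nodup ∧ ∀ x, x ∈ l) hl).mpr ?_
      refine ⟨List.nodup_append'.2 ⟨hs₁.1.map Sum.inl_injective,
        hs₂.1.map Sum.inr_injective, ?_⟩, ?_⟩
      · intro x hx hx'
        simp only [List.mem_map] at hx hx'
        obtain ⟨_, _, rfl⟩ := hx
        obtain ⟨_, _, hx'⟩ := hx'
        cases hx'
      · rintro (z | w)
        · simp [hs₁.2 z]
        · simp [hs₂.2 w]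
    · exact congrArg₂ (CTree.node a h) (CTree.map_map (χ' := Sum.elim χ₁ χ₂) _ _ _ hg s₁)
        (CTree.map_map (χ' := Sum.elim χ₁ χ₂) _ _ _ hg s₂)

/-- The span of all relabellings, along maps that need not be injective, of elements of an
operadic ideal. -/
noncomputable def OperadIdeal.rawSpan (J : OperadIdeal k S) {X : Type} (χ : X → I) (c : I) :
    Submodule k (CTree S χ c →₀ k) :=
  Submodule.span k {q | ∃ (Y : Type) (_ : Finite Y) (χ' : Y → I) (f : Y → X)
    (hf : ∀ y, χ (f y) = χ' y) (p : FreeOp k S χ' c), p ∈ J.carrier Y χ' c ∧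
      q = mapDomain (fun t => t.1.map f hf) p}

theorem FreeOp.comp_single {X Y : Type} {χ : X → I} {χ' : Y → I} {c : I} (p : FreeOp k S χ c)
    (x : X) (s : TreeMonomial S χ' (χ x)) :
    FreeOp.comp p x (Finsupp.single s 1) = mapDomain (fun t => t.comp x s) p := by
  rw [FreeOp.comp, mapDomain]
  congr 1
  funext t a
  rw [Finsupp.sum_single_index (by simp), mul_one]

theorem FreeOp.single_comp {X Y : Type} {χ : X → I} {χ' : Y → I} {c : I}
    (t : TreeMonomial S χ c) (x : X) (q : FreeOp k S χ' (χ x)) :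
    FreeOp.comp (Finsupp.single t 1) x q = mapDomain (fun s => t.comp x s) q := by
  rw [FreeOp.comp, mapDomain, Finsupp.sum_single_index (by simp)]
  simp only [one_mul]

open Classical in
theorem CTree.graft_bind {X Y Z : Type} {χ : X → I} {χ' : Y → I} {χ'' : Z → I} {c : I}
    (t : CTree S χ c) (x : X) (s : CTree S χ' (χ x))
    (f : ∀ w c, graftColour χ χ' x w = c → CTree S χ'' c) :
    (t.graft x s).bind f = t.bind (fun z c h =>
      if hz : z = x then (show χ x = c from hz ▸ h) ▸ s.bind (fun y c h => f (Sum.inr y) c h)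
      else f (Sum.inl ⟨z, hz⟩) c h) := by
  rw [graft, bind_bind]
  congr 1
  funext z c h
  by_cases hz : z = x
  · subst hz
    subst h
    simp only [dite_true]
    exact bind_bind _ _ s
  · simp [hz, bind]

/-- A tree that consists of a leaf only. -/
def CTree.IsLeaf {X : Type} {χ : X → I} {c : I} (t : CTree S χ c) : Prop :=
  ∃ x h, t = .leaf x h

/-- A simultaneous substitution is a sequence of partial compositions followed by a relabelling. The
induction is on the number of inputs that receive a tree other than a leaf; when there are none, the
substitution is a relabelling, possibly not injective. -/
theorem OperadIdeal.bind_mem_rawSpan (J : OperadIdeal k S) {X Y : Type} [Finite Y] {χ : X → I}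
    {χ' : Y → I} {c : I} (f : ∀ (y : Y) (c : I), χ' y = c → CTree S χ c) (p : FreeOp k S χ' c)
    (hp : p ∈ J.carrier Y χ' c) :
    mapDomain (fun t => t.1.bind f) p ∈ J.rawSpan χ c := by
  induction hn : Nat.card {y : Y // ¬ (f y _ rfl).IsLeaf} using Nat.strong_induction_on
    generalizing Y with
  | _ n ih =>
  by_cases hf : ∀ y, (f y _ rfl).IsLeaf
  · choose g hg hfg using hf
    refine Submodule.subset_span ⟨Y, inferInstance, χ', g, hg, p, hp, ?_⟩
    congr 1
    funext t
    rw [CTree.map]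
    congr 1
    funext y c h
    subst h
    exact hfg y
  · push Not at hf
    obtain ⟨x, hx⟩ := hf
    obtain ⟨Z, _, χZ, g, hg, s, hs⟩ := (f x _ rfl).exists_linear_map
    have h1 := J.comp_mem_left p x (Finsupp.single s 1) hp
    rw [FreeOp.comp_single] at h1
    -- After grafting the monomial `s` at `x`, its inputs only need renaming by `g`. The new inputs
    -- thus receive leaves, and `x` no longer counts.
    let f' : ∀ (w : {z : Y // z ≠ x} ⊕ Z) (c : I), graftColour χ' χZ x w = c → CTree S χ c :=
      fun w => match w with
        | Sum.inl z => fun c h => f z.1 c h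
        | Sum.inr z => fun c h => .leaf (g z) ((hg z).trans h)
    have h2 := ih (Nat.card {w // ¬ (f' w _ rfl).IsLeaf}) ?_ f' _ h1 rfl
    · rw [← Finsupp.mapDomain_comp] at h2
      convert h2 using 2
      funext t
      simp only [Function.comp, TreeMonomial.comp]
      rw [CTree.graft_bind]
      congr 1
      funext z c h
      by_cases hz : z = x
      · subst hz
        subst h
        simp only [dite_true]
        exact hs.symm
      · simp [hz, f']
    · rw [← hn]
      have key : ∀ w, ¬ (f' w _ rfl).IsLeaf → ∃ z : {z : Y // z ≠ x}, w = Sum.inl z ∧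
          ¬ (f z.1 _ rfl).IsLeaf := by
        rintro (z | z) hz
        · exact ⟨z, rfl, hz⟩
        · exact absurd ⟨_, _, rfl⟩ hz
      choose φ hφ hφ' using key
      have := Fintype.ofFinite {w // ¬ (f' w _ rfl).IsLeaf}
      have := Fintype.ofFinite {y : Y // ¬ (f y _ rfl).IsLeaf}
      rw [Nat.card_eq_fintype_card, Nat.card_eq_fintype_card]
      refine Fintype.card_lt_of_injective_of_notMem
        (fun w : {w // ¬ (f' w _ rfl).IsLeaf} =>
        (⟨(φ w.1 w.2).1, hφ' w.1 w.2⟩ : {y : Y // ¬ (f y _ rfl).IsLeaf})) ?_ (b := ⟨x, hx⟩) ?_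
      · intro w w' h
        have h' : φ w.1 w.2 = φ w'.1 w'.2 := Subtype.ext (congrArg (fun y => y.1) h)
        exact Subtype.ext ((hφ w.1 w.2).trans ((congrArg Sum.inl h').trans (hφ w'.1 w'.2).symm))
      · rintro ⟨w, hw⟩
        exact (φ w.1 w.2).2 (congrArg Subtype.val hw)

/-- The tree with a single vertex. -/
def TreeMonomial.corolla (S : BinarySignature I) (g : S.Gen) :
    TreeMonomial S (fun b : Bool => bif b then S.in₂ g else S.in₁ g) (S.out g) :=
  ⟨.node g rfl (.leaf false rfl) (.leaf true rfl), by
    constructor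
    · simp [CTree.leaves]
    · rintro (_ | _) <;> simp [CTree.leaves]⟩

/-- Composing a corolla with an element of the ideal at the input `false` stays in the ideal; `r` is
then substituted for the remaining input `true`. -/
theorem OperadIdeal.node_left_mem_rawSpan (J : OperadIdeal k S) {X : Type} {χ : X → I} {c : I}
    (g : S.Gen) (h : S.out g = c) (r : CTree S χ (S.in₂ g)) (q : CTree S χ (S.in₁ g) →₀ k)
    (hq : q ∈ J.rawSpan χ (S.in₁ g)) :
    mapDomain (fun l => CTree.node g h l r) q ∈ J.rawSpan χ c := by
  subst h
  refine Submodule.span_induction (p := fun q _ => mapDomain (fun l => CTree.node g rfl l r) q ∈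
    J.rawSpan χ (S.out g)) ?_ ?_ ?_ ?_ hq
  · rintro _ ⟨Y, _, χ', f, hf, p, hp, rfl⟩
    have h1 := J.comp_mem_right (Finsupp.single (TreeMonomial.corolla S g) 1) false p hp
    rw [FreeOp.single_comp] at h1
    have h2 := J.bind_mem_rawSpan (χ := χ) (fun w => match w with
      | Sum.inl ⟨true, _⟩ => fun c h => h ▸ r
      | Sum.inl ⟨false, hf⟩ => absurd rfl hf
      | Sum.inr y => fun c h => .leaf (f y) ((hf y).trans h)) _ h1
    rw [← Finsupp.mapDomain_comp] at h2 ⊢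
    refine (congrArg (· ∈ J.rawSpan χ (S.out g)) (Finsupp.mapDomain_congr fun t _ => ?_)).mp h2
    simp only [Function.comp, TreeMonomial.comp]
    rw [CTree.graft_bind]
    simp [TreeMonomial.corolla, CTree.bind]
    rfl
  · simp
  · intro x y _ _ hx hy
    rw [Finsupp.mapDomain_add]
    exact add_mem hx hy
  · intro a x _ hx
    rw [Finsupp.mapDomain_smul]
    exact Submodule.smul_mem _ _ hx

theorem OperadIdeal.node_right_mem_rawSpan (J : OperadIdeal k S) {X : Type} {χ : X → I} {c : I}
    (g : S.Gen) (h : S.out g = c) (l : CTree S χ (S.in₁ g)) (q : CTree S χ (S.in₂ g) →₀ k)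
    (hq : q ∈ J.rawSpan χ (S.in₂ g)) :
    mapDomain (fun r => CTree.node g h l r) q ∈ J.rawSpan χ c := by
  subst h
  refine Submodule.span_induction (p := fun q _ => mapDomain (fun r => CTree.node g rfl l r) q ∈
    J.rawSpan χ (S.out g)) ?_ ?_ ?_ ?_ hq
  · rintro _ ⟨Y, _, χ', f, hf, p, hp, rfl⟩
    have h1 := J.comp_mem_right (Finsupp.single (TreeMonomial.corolla S g) 1) true p hp
    rw [FreeOp.single_comp] at h1
    have h2 := J.bind_mem_rawSpan (χ := χ) (fun w => match w with
      | Sum.inl ⟨false, _⟩ => fun c h => h ▸ l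
      | Sum.inl ⟨true, hf⟩ => absurd rfl hf
      | Sum.inr y => fun c h => .leaf (f y) ((hf y).trans h)) _ h1
    rw [← Finsupp.mapDomain_comp] at h2 ⊢
    refine (congrArg (· ∈ J.rawSpan χ (S.out g)) (Finsupp.mapDomain_congr fun t _ => ?_)).mp h2
    simp only [Function.comp, TreeMonomial.comp]
    rw [CTree.graft_bind]
    simp [TreeMonomial.corolla, CTree.bind]
    rfl
  · simp
  · intro x y _ _ hx hy
    rw [Finsupp.mapDomain_add]
    exact add_mem hx hy
  · intro a x _ hx
    rw [Finsupp.mapDomain_smul]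
    exact Submodule.smul_mem _ _ hx

/-- The part of a combination of trees that is supported on tree monomials. -/
noncomputable def linearPart (k : Type u) [Field k] {X : Type} (χ : X → I) (c : I) :
    (CTree S χ c →₀ k) →ₗ[k] FreeOp k S χ c :=
  Finsupp.lcomapDomain Subtype.val Subtype.val_injective

theorem linearPart_single {X : Type} {χ : X → I} {c : I} (t : TreeMonomial S χ c) (a : k) :
    linearPart k χ c (Finsupp.single t.1 a) = Finsupp.single t a :=
  Finsupp.comapDomain_single _ _ _ _

theorem linearPart_single_of_not {X : Type} {χ : X → I} {c : I} (t : CTree S χ c) (a : k)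
    (ht : ¬ t.IsLinear) : linearPart k χ c (Finsupp.single t a) = 0 := by
  ext s
  change Finsupp.single t a s.1 = 0
  exact Finsupp.single_eq_of_ne fun h => ht (h ▸ s.2)

/-- Relabelling along a bijection is the action of its inverse, which preserves the ideal.
Relabelling along any other map repeats or omits a label in every monomial, so nothing linear
survives. -/
theorem OperadIdeal.linearPart_mem (J : OperadIdeal k S) {X : Type} [Finite X] {χ : X → I}
    {c : I} (q : CTree S χ c →₀ k) (hq : q ∈ J.rawSpan χ c) :
    linearPart k χ c q ∈ J.carrier X χ c := by
  refine Submodule.span_le (p := (J.carrier X χ c).comap (linearPart k χ c)) |>.2 ?_ hq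
  rintro _ ⟨Y, _, χ', f, hf, p, hp, rfl⟩
  rw [SetLike.mem_coe, Submodule.mem_comap]
  by_cases hb : Function.Bijective f
  · obtain rfl : χ' = χ ∘ f := funext fun y => (hf y).symm
    obtain ⟨e, rfl⟩ : ∃ e : X ≃ Y, ⇑e.symm = f := ⟨(Equiv.ofBijective f hb).symm, rfl⟩
    have h1 := J.res_mem e _ _ p hp
    have h2 : (χ ∘ e.symm) ∘ e = χ := by ext; simp
    -- The colouring is generalised because it agrees with `χ` only propositionally.
    have key : ∀ (χ₀ : X → I) (h2 : (χ ∘ e.symm) ∘ e = χ₀) (hf : ∀ y, χ₀ (e.symm y) = _),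
        FreeOp.res e (χ ∘ e.symm) c p ∈ J.carrier X ((χ ∘ e.symm) ∘ e) c →
        linearPart k χ₀ c (mapDomain (fun t => t.1.map e.symm hf) p) ∈ J.carrier X χ₀ c := by
      rintro _ rfl hf h
      convert h using 1
      rw [FreeOp.res]
      refine LinearMap.congr_fun (f := linearPart k _ c ∘ₗ Finsupp.lmapDomain k k _) ?_ p
      refine Finsupp.lhom_ext fun t a => ?_
      simp only [LinearMap.comp_apply, Finsupp.lmapDomain_apply, Finsupp.mapDomain_single]
      exact linearPart_single (TreeMonomial.res e _ t) a
    exact key χ h2 hf h1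
  · convert Submodule.zero_mem _
    refine LinearMap.congr_fun (f := linearPart k _ c ∘ₗ Finsupp.lmapDomain k k _) (g := 0) ?_ p
    refine Finsupp.lhom_ext fun t a => ?_
    simp only [LinearMap.comp_apply, Finsupp.lmapDomain_apply, Finsupp.mapDomain_single]
    refine linearPart_single_of_not _ _ fun hl => hb ?_
    rw [CTree.IsLinear, CTree.leaves_map] at hl
    constructor
    · intro y y' h
      exact List.inj_on_of_nodup_map hl.1 (t.2.2 y) (t.2.2 y') h
    · intro x
      obtain ⟨y, _, h⟩ := List.mem_map.1 (hl.2 x)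
      exact ⟨y, h⟩

end Raw

/-! ### Evaluation in free associative algebras -/

section Assoc

variable {k : Type u} [Field k] {I : Type} {S : BinarySignature I}

/-- The evaluation of a tree in the free associative algebra on the labels, where the generator
`g` is the operation `(u, v) ↦ a g • u * v + b g • v * u`. -/
noncomputable def CTree.assoc {k : Type u} [Field k] {I : Type} {S : BinarySignature I} {X : Type}
    {χ : X → I} (a b : S.Gen → k) : {c : I} → CTree S χ c → FreeAlgebra k X
  | _, .leaf x _ => FreeAlgebra.ι k x
  | _, .node g _ l r =>
    a g • (l.assoc a b * r.assoc a b) + b g • (r.assoc a b * l.assoc a b)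

variable (a b : S.Gen → k) {X Y : Type} {χ : X → I} {χ' : Y → I} {c : I}

theorem CTree.assoc_bind (f : ∀ (x : X) (c : I), χ x = c → CTree S χ' c) (t : CTree S χ c) :
    (t.bind f).assoc a b = FreeAlgebra.lift k (fun x => (f x _ rfl).assoc a b) (t.assoc a b) := by
  induction t with
  | leaf x h => subst h; simp [bind, assoc]
  | node g h l r ihl ihr => simp [bind, assoc, ihl, ihr]

theorem CTree.assoc_map (f : X → Y) (hf : ∀ x, χ' (f x) = χ x) (t : CTree S χ c) :
    (t.map f hf).assoc a b = FreeAlgebra.lift k (fun x => FreeAlgebra.ι k (f x)) (t.assoc a b) :=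
  CTree.assoc_bind a b _ t

theorem CTree.graft_congr (t : CTree S χ c) (x : X) (hx : x ∉ t.leaves)
    (s s' : CTree S χ' (χ x)) : t.graft x s = t.graft x s' := by
  induction t with
  | leaf z h =>
    have hz : z ≠ x := by
      rintro rfl
      simp [leaves] at hx
    simp [graft, bind, hz]
  | node g h l r ihl ihr =>
    simp only [leaves, List.mem_append, not_or] at hx
    exact congrArg₂ (CTree.node g h) (ihl hx.1) (ihr hx.2)

/-- Since `x` marks exactly one leaf, only one factor of each product depends on `s`, so the value
depends linearly on that of `s`. A repeated label would destroy this. -/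
theorem CTree.exists_linearMap_graft (t : CTree S χ c) (x : X) (hx : x ∈ t.leaves)
    (ht : t.leaves.Nodup) : ∃ M : FreeAlgebra k Y →ₗ[k] FreeAlgebra k ({z : X // z ≠ x} ⊕ Y),
      ∀ s : CTree S χ' (χ x), (t.graft x s).assoc a b = M (s.assoc a b) := by
  induction t with
  | leaf z h =>
    obtain rfl : x = z := by simpa [leaves] using hx
    subst h
    refine ⟨(FreeAlgebra.lift k (fun y => FreeAlgebra.ι k (Sum.inr y))).toLinearMap, fun s => ?_⟩
    simp only [graft, bind, dite_true]
    exact CTree.assoc_map (χ' := graftColour χ χ' x) a b Sum.inr (fun _ => rfl) s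
  | node g h l r ihl ihr =>
    simp only [leaves, List.mem_append, List.nodup_append'] at hx ht
    have e : ∀ s, ((CTree.node g h l r).graft x s : CTree S (graftColour χ χ' x) _).assoc a b =
      a g • ((l.graft x s).assoc a b * (r.graft x s).assoc a b)
        + b g • ((r.graft x s).assoc a b * (l.graft x s).assoc a b) := fun s => rfl
    -- A tree `s₀` is needed to name the factor in which `x` does not occur; without any such tree
    -- the claim is vacuous.
    rcases isEmpty_or_nonempty (CTree S χ' (χ x)) with he | ⟨⟨s₀⟩⟩
    · exact ⟨0, fun s => he.elim s⟩
    rcases hx with hx | hx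
    · obtain ⟨M, hM⟩ := ihl hx ht.1
      have hr := fun s => r.graft_congr x (fun h => ht.2.2 hx h) s s₀
      refine ⟨a g • (LinearMap.mulRight k ((r.graft x s₀).assoc a b) ∘ₗ M)
        + b g • (LinearMap.mulLeft k ((r.graft x s₀).assoc a b) ∘ₗ M), fun s => ?_⟩
      rw [e, hr s, hM s]
      rfl
    · obtain ⟨M, hM⟩ := ihr hx ht.2.1
      have hl := fun s => l.graft_congr x (fun h => ht.2.2 h hx) s s₀
      refine ⟨a g • (LinearMap.mulLeft k ((l.graft x s₀).assoc a b) ∘ₗ M)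
        + b g • (LinearMap.mulRight k ((l.graft x s₀).assoc a b) ∘ₗ M), fun s => ?_⟩
      rw [e, hl s, hM s]
      rfl

/-- The evaluation of operations of the free operad in the free associative algebra. -/
noncomputable def FreeOp.assoc (χ : X → I) (c : I) : FreeOp k S χ c →ₗ[k] FreeAlgebra k X :=
  Finsupp.linearCombination k (fun t => t.1.assoc a b)

theorem FreeOp.assoc_single (t : TreeMonomial S χ c) (r : k) :
    FreeOp.assoc a b χ c (Finsupp.single t r) = r • t.1.assoc a b :=
  Finsupp.linearCombination_single _ _ _

theorem FreeOp.assoc_mono (t : CTree S χ c) (h : t.IsLinear) :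
    FreeOp.assoc a b χ c (mono k t h) = t.assoc a b :=
  (FreeOp.assoc_single a b ⟨t, h⟩ 1).trans (one_smul _ _)

theorem FreeOp.comp_eq_sum_right (p : FreeOp k S χ c) (x : X) (q : FreeOp k S χ' (χ x)) :
    FreeOp.comp p x q = q.sum fun s r => r • mapDomain (fun t => t.comp x s) p := by
  rw [FreeOp.comp, Finsupp.sum_comm]
  congr 1
  funext s r
  rw [mapDomain, Finsupp.smul_sum]
  simp [mul_comm]

theorem FreeOp.comp_eq_sum_left (p : FreeOp k S χ c) (x : X) (q : FreeOp k S χ' (χ x)) :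
    FreeOp.comp p x q = p.sum fun t r => r • mapDomain (fun s => t.comp x s) q := by
  rw [FreeOp.comp]
  congr 1
  funext s r
  rw [mapDomain, Finsupp.smul_sum]
  simp

/-- The kernel of the evaluation in free associative algebras. -/
noncomputable def assocIdeal : OperadIdeal k S where
  carrier X _ χ c := LinearMap.ker (FreeOp.assoc a b χ c)
  res_mem e χ c p hp := by
    rw [LinearMap.mem_ker] at hp ⊢
    have h : FreeOp.assoc a b (χ ∘ e) c ∘ₗ FreeOp.res e χ c =
        (FreeAlgebra.lift k (fun x => FreeAlgebra.ι k (e.symm x))).toLinearMap ∘ₗ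
          FreeOp.assoc a b χ c := by
      refine Finsupp.lhom_ext fun t r => ?_
      simp only [LinearMap.comp_apply, FreeOp.res, Finsupp.lmapDomain_apply,
        Finsupp.mapDomain_single, FreeOp.assoc_single, map_smul]
      congr 1
      exact CTree.assoc_map (χ' := χ ∘ e) a b e.symm (fun y => by simp) t.1
    have h' := LinearMap.congr_fun h p
    rw [LinearMap.comp_apply, LinearMap.comp_apply, hp, map_zero] at h'
    exact h'
  comp_mem_left {X Y} _ _ {χ χ' c} p x q hp := by
    rw [LinearMap.mem_ker] at hp ⊢
    rw [FreeOp.comp_eq_sum_right, map_finsuppSum]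
    refine Finset.sum_eq_zero fun s _ => ?_
    classical
    -- Grafting `s` at `x` becomes the algebra homomorphism that replaces the letter `x` by the
    -- value of `s`. The final `else 0` is never reached.
    have h : FreeOp.assoc a b (graftColour χ χ' x) c ∘ₗ
          Finsupp.lmapDomain k k (fun t => t.comp x s) =
        (FreeAlgebra.lift k (fun z => if z = x then
          FreeAlgebra.lift k (fun y => FreeAlgebra.ι k (Sum.inr y)) (s.1.assoc a b)
          else if hz : z ≠ x then FreeAlgebra.ι k (Sum.inl ⟨z, hz⟩) else 0)).toLinearMap ∘ₗ
          FreeOp.assoc a b χ c := by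
      refine Finsupp.lhom_ext fun t r => ?_
      simp only [LinearMap.comp_apply, Finsupp.lmapDomain_apply,
        Finsupp.mapDomain_single, FreeOp.assoc_single, map_smul]
      congr 1
      refine (CTree.assoc_bind _ _ _ _).trans ?_
      refine DFunLike.congr_fun (congrArg (FreeAlgebra.lift k) (funext fun z => ?_)) _
      by_cases hz : z = x
      · subst hz
        simp only [dite_true, if_true]
        exact CTree.assoc_map (χ' := graftColour χ χ' z) a b Sum.inr (fun _ => rfl) s.1
      · simp [hz, CTree.assoc]
    have h' := LinearMap.congr_fun h p
    rw [LinearMap.comp_apply, LinearMap.comp_apply, hp, map_zero, Finsupp.lmapDomain_apply] at h'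
    exact (map_smul _ _ _).trans (by rw [h', smul_zero])
  comp_mem_right {X Y} _ _ {χ χ' c} p x q hq := by
    rw [LinearMap.mem_ker] at hq ⊢
    rw [FreeOp.comp_eq_sum_left, map_finsuppSum]
    refine Finset.sum_eq_zero fun t _ => ?_
    obtain ⟨M, hM⟩ := CTree.exists_linearMap_graft (χ' := χ') a b t.1 x (t.2.2 x) t.2.1
    have h : FreeOp.assoc a b (graftColour χ χ' x) c ∘ₗ
          Finsupp.lmapDomain k k (fun s => t.comp x s) = M ∘ₗ FreeOp.assoc a b χ' (χ x) := by
      refine Finsupp.lhom_ext fun s r => ?_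
      simp only [LinearMap.comp_apply, Finsupp.lmapDomain_apply,
        Finsupp.mapDomain_single, FreeOp.assoc_single, map_smul]
      congr 1
      exact hM s.1
    have h' := LinearMap.congr_fun h q
    rw [LinearMap.comp_apply, LinearMap.comp_apply, hq, map_zero, Finsupp.lmapDomain_apply] at h'
    exact (map_smul _ _ _).trans (by rw [h', smul_zero])

theorem mem_assocIdeal [Finite X] (p : FreeOp k S χ c) :
    p ∈ (assocIdeal a b).carrier X χ c ↔ FreeOp.assoc a b χ c p = 0 :=
  LinearMap.mem_ker

theorem OperadIdeal.subset_generate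
    (R : ∀ (X : Type) [Finite X] (χ : X → I) (c : I), Set (FreeOp k S χ c)) (X : Type) [Finite X]
    (χ : X → I) (c : I) : R X χ c ⊆ (OperadIdeal.generate R).carrier X χ c :=
  fun _ hp => Submodule.mem_iInf _ |>.2 fun J => J.2 X χ c hp

theorem OperadIdeal.generate_le
    (R : ∀ (X : Type) [Finite X] (χ : X → I) (c : I), Set (FreeOp k S χ c)) (J : OperadIdeal k S)
    (h : ∀ (X : Type) [Finite X] (χ : X → I) (c : I), R X χ c ⊆ J.carrier X χ c) (X : Type)
    [Finite X] (χ : X → I) (c : I) :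
    (OperadIdeal.generate R).carrier X χ c ≤ J.carrier X χ c :=
  iInf_le_of_le ⟨J, h⟩ le_rfl

end Assoc

/-- Write an element of the kernel as n + Σ s(w) v(w) with n in `N`. Applying `f` kills n, so
independence of the values gives s = 0. The same computation shows that the family is independent
modulo `N`. -/
theorem eq_ker_and_bijective_of_linearIndependent {k V A W : Type*} [Field k]
    [AddCommGroup V] [Module k V] [AddCommGroup A] [Module k A] (f : V →ₗ[k] A)
    (N : Submodule k V) (hN : N ≤ LinearMap.ker f) (v : W → V)
    (hv : N ⊔ Submodule.span k (Set.range v) = ⊤) (hl : LinearIndependent k (fun w => f (v w))) :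
    N = LinearMap.ker f ∧
      Function.Bijective (N.mkQ ∘ₗ Finsupp.linearCombination k v) := by
  have hf : ∀ s, f (Finsupp.linearCombination k v s) = 0 → s = 0 := fun s hs =>
    linearIndependent_iff.1 hl s (by
      rw [← hs, Finsupp.linearCombination_apply, Finsupp.linearCombination_apply, map_finsuppSum]
      simp)
  refine ⟨le_antisymm hN fun p hp => ?_, ?_, fun y => ?_⟩
  · obtain ⟨n, hn, s, hs, rfl⟩ := Submodule.mem_sup.1 (hv ▸ Submodule.mem_top (x := p))
    obtain ⟨s, rfl⟩ := (Finsupp.mem_span_range_iff_exists_finsupp).1 hs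
    have h1 : f n = 0 := hN hn
    rw [LinearMap.mem_ker, map_add, h1, zero_add] at hp
    have := hf s hp
    subst this
    simpa using hn
  · rw [injective_iff_map_eq_zero]
    intro s hs
    exact hf s (hN ((Submodule.Quotient.mk_eq_zero N).1 hs))
  · obtain ⟨p, rfl⟩ := N.mkQ_surjective y
    obtain ⟨n, hn, s, hs, rfl⟩ := Submodule.mem_sup.1 (hv ▸ Submodule.mem_top (x := p))
    obtain ⟨s, rfl⟩ := (Finsupp.mem_span_range_iff_exists_finsupp).1 hs
    refine ⟨s, ?_⟩
    have hn' : N.mkQ n = 0 := (Submodule.Quotient.mk_eq_zero N).2 hn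
    rw [map_add, hn', zero_add]
    rfl

/-! ### Words and their first letters -/

section Words

variable (k : Type u) [Field k] {X : Type}

/-- The monomial of the free associative algebra given by a word. -/
noncomputable def word (l : List X) : FreeAlgebra k X := (l.map (FreeAlgebra.ι k)).prod

theorem word_append (l l' : List X) : word k (l ++ l') = word k l * word k l' := by
  simp [word]

theorem word_cons (x : X) (l : List X) : word k (x :: l) = FreeAlgebra.ι k x * word k l := by
  simp [word]

theorem word_singleton (x : X) : word k [x] = FreeAlgebra.ι k x := by
  simp [word]

theorem basisFreeMonoid_apply (l : List X) :
    FreeAlgebra.basisFreeMonoid k X (FreeMonoid.ofList l) = word k l := by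
  simp [FreeAlgebra.basisFreeMonoid, FreeAlgebra.equivMonoidAlgebraFreeMonoid, word,
    FreeMonoid.lift_apply]

theorem linearIndependent_word : LinearIndependent k (word k : List X → FreeAlgebra k X) := by
  have h := (FreeAlgebra.basisFreeMonoid k X).linearIndependent
  exact (funext (basisFreeMonoid_apply k) : _ = word k (X := X)) ▸ h

theorem span_word : Submodule.span k (Set.range (word k : List X → FreeAlgebra k X)) = ⊤ := by
  have h := (FreeAlgebra.basisFreeMonoid k X).span_eq
  exact (funext (basisFreeMonoid_apply k) : _ = word k (X := X)) ▸ h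

/-- The span of the words that begin with a letter different from `x`. -/
noncomputable def otherHead (x : X) : Submodule k (FreeAlgebra k X) :=
  Submodule.span k {f | ∃ y l, y ≠ x ∧ f = word k (y :: l)}

variable {k}

theorem ι_mul_mem_otherHead {x y : X} (h : y ≠ x) (f : FreeAlgebra k X) :
    FreeAlgebra.ι k y * f ∈ otherHead k x := by
  have hf : f ∈ Submodule.span k (Set.range (word k : List X → FreeAlgebra k X)) := by
    rw [span_word]; trivial
  refine Submodule.span_le
    (p := (otherHead k x).comap (LinearMap.mulLeft k (FreeAlgebra.ι k y))) |>.2 ?_ hf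
  rintro _ ⟨l, rfl⟩
  exact Submodule.subset_span ⟨y, l, h, (word_cons k y l).symm⟩

theorem mul_ι_mem_otherHead {x : X} (y : X) {f : FreeAlgebra k X} (hf : f ∈ otherHead k x) :
    f * FreeAlgebra.ι k y ∈ otherHead k x := by
  refine Submodule.span_le
    (p := (otherHead k x).comap (LinearMap.mulRight k (FreeAlgebra.ι k y))) |>.2 ?_ hf
  rintro _ ⟨z, l, h, rfl⟩
  refine Submodule.subset_span ⟨z, l ++ [y], h, ?_⟩
  rw [LinearMap.mulRight_apply, ← word_singleton, ← word_append]
  rfl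

/-- The coefficient of a word. -/
noncomputable def wordCoeff (l : List X) : FreeAlgebra k X →ₗ[k] k :=
  (FreeAlgebra.basisFreeMonoid k X).coord (FreeMonoid.ofList l)

open Classical in
theorem wordCoeff_word (l l' : List X) :
    wordCoeff l (word k l') = if l' = l then 1 else 0 := by
  rw [← basisFreeMonoid_apply, wordCoeff, Module.Basis.coord_apply, Module.Basis.repr_self,
    Finsupp.single_apply]
  exact if_congr Iff.rfl rfl rfl

theorem wordCoeff_otherHead {x : X} (l : List X) {f : FreeAlgebra k X}
    (hf : f ∈ otherHead k x) : wordCoeff (x :: l) f = 0 := by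
  refine Submodule.span_le (p := LinearMap.ker (wordCoeff (k := k) (x :: l))) |>.2 ?_ hf
  rintro _ ⟨y, l', h, rfl⟩
  rw [SetLike.mem_coe, LinearMap.mem_ker, wordCoeff_word, if_neg]
  intro h'
  exact h (List.cons.inj h').1

end Words

/-! ### Left-normed brackets -/

namespace Lie

variable {k : Type u} [Field k] {X : Type}

theorem tree_induction {P : CTree lieSig (col X) () → Prop} (leaf : ∀ x, P (inp x))
    (node : ∀ l r, P l → P r → P (br l r)) (t : CTree lieSig (col X) ()) : P t := by
  have h : ∀ {c : Unit} (t : CTree lieSig (col X) c), P t := fun {c} t => by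
    induction t with
    | leaf x _ => exact leaf x
    | node g _ l r ihl ihr =>
      cases g
      exact node l r ihl ihr
  exact h t

/-- The left-normed bracket `[…[[x, yₙ], yₙ₋₁], …, y₁]`. -/
def leftNormed (x : X) : List X → CTree lieSig (col X) ()
  | [] => inp x
  | y :: w => br (leftNormed x w) (inp y)

theorem leaves_leftNormed (x : X) (w : List X) : (leftNormed x w).leaves = x :: w.reverse := by
  induction w with
  | nil => rfl
  | cons y w ih =>
    change (leftNormed x w).leaves ++ [y] = _
    simp [ih]

variable (k) in
/-- The commutator in the free associative algebra. -/
noncomputable abbrev commutator : CTree lieSig (col X) () → FreeAlgebra k X :=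
  CTree.assoc (fun _ => 1) (fun _ => -1)

theorem commutator_br (l r : CTree lieSig (col X) ()) :
    commutator k (br l r) = commutator k l * commutator k r - commutator k r * commutator k l := by
  change (1 : k) • (_ * _) + (-1 : k) • (_ * _) = _
  rw [one_smul, neg_one_smul, sub_eq_add_neg]

/-- In [L, y] = Ly - yL the product yL starts with y ≠ x, and Ly appends y to the leading word of L.
The list is reversed because its head is the letter bracketed last. -/
theorem commutator_leftNormed (x : X) (w : List X) (h : x ∉ w) :
    commutator k (leftNormed x w) - word k (x :: w.reverse) ∈ otherHead k x := by
  induction w with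
  | nil =>
    rw [List.reverse_nil, word_singleton]
    change FreeAlgebra.ι k x - _ ∈ _
    rw [sub_self]
    exact zero_mem _
  | cons y w ih =>
    simp only [List.mem_cons, not_or] at h
    have h1 := mul_ι_mem_otherHead y (ih h.2)
    have h2 := ι_mul_mem_otherHead (k := k) (Ne.symm h.1) (commutator k (leftNormed x w))
    have h3 : commutator k (inp y) = FreeAlgebra.ι k y := rfl
    rw [leftNormed, commutator_br, List.reverse_cons, ← List.cons_append, word_append,
      word_singleton, h3]
    convert sub_mem h1 h2 using 1
    noncomm_ring

theorem linearIndependent_commutator_leftNormed (x : X) :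
    LinearIndependent k
      (fun w : {w : List X // x ∉ w} => commutator k (leftNormed x w.1)) := by
  classical
  rw [linearIndependent_iff]
  intro s hs
  ext v
  -- The coefficients of the words starting with `x` form a family dual to the left-normed brackets.
  have h : wordCoeff (x :: v.1.reverse) ∘ₗ Finsupp.linearCombination k
      (fun w : {w : List X // x ∉ w} => commutator k (leftNormed x w.1)) = Finsupp.lapply v := by
    refine Finsupp.lhom_ext fun w r => ?_
    have hw := wordCoeff_otherHead v.1.reverse (commutator_leftNormed (k := k) x w.1 w.2)
    rw [map_sub, wordCoeff_word, sub_eq_zero] at hw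
    rw [LinearMap.comp_apply, Finsupp.linearCombination_single, map_smul, hw,
      Finsupp.lapply_apply, Finsupp.single_apply]
    simp [Subtype.ext_iff]
  have h' := LinearMap.congr_fun h s
  rw [LinearMap.comp_apply, hs, map_zero] at h'
  exact h'.symm

section Span

variable (N : Submodule k (CTree lieSig (col X) () →₀ k))

/-- The span of left-normed brackets modulo a subspace of relations. -/
noncomputable def leftNormedSpan (x : X) : Submodule k (CTree lieSig (col X) () →₀ k) :=
  N ⊔ Submodule.span k (Set.range fun w => Finsupp.single (leftNormed x w) 1)

/-- A subspace of the span of trees that contains all instances of the relations of `Lie` and is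
closed under brackets. -/
structure IsRelationSpace : Prop where
  br_left : ∀ q ∈ N, ∀ r, mapDomain (fun l => br l r) q ∈ N
  antisymm : ∀ a b, Finsupp.single (br a b) 1 + Finsupp.single (br b a) 1 ∈ N
  jacobi : ∀ a b c, Finsupp.single (br (br a b) c) 1 - Finsupp.single (br (br a c) b) 1
    - Finsupp.single (br a (br b c)) 1 ∈ N

variable {N} (hN : IsRelationSpace N) (x : X)
include hN

theorem IsRelationSpace.br_mem_leftNormedSpan {r : CTree lieSig (col X) ()}
    (hr : ∀ w, Finsupp.single (br (leftNormed x w) r) 1 ∈ leftNormedSpan N x)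
    (q : CTree lieSig (col X) () →₀ k) (hq : q ∈ leftNormedSpan N x) :
    mapDomain (fun l => br l r) q ∈ leftNormedSpan N x := by
  refine (sup_le (a := N) (c := (leftNormedSpan N x).comap
    (Finsupp.lmapDomain k k (fun l => br l r))) ?_ ?_) hq
  · exact fun q hq => Submodule.mem_sup_left (hN.br_left q hq r)
  · rw [Submodule.span_le]
    rintro _ ⟨w, rfl⟩
    simpa using hr w

/-- By Jacobi, [L,[a,b]] = [[L,a],b] - [[L,b],a], and the brackets on the right have smaller second
arguments. The statement for all `w` is what lets the second bracketing act on whatever combination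
the first produces. -/
theorem IsRelationSpace.leftNormed_br_mem (r : CTree lieSig (col X) ()) :
    ∀ w, Finsupp.single (br (leftNormed x w) r) 1 ∈ leftNormedSpan N x := by
  induction r using tree_induction with
  | leaf y =>
    exact fun w => Submodule.mem_sup_right (Submodule.subset_span ⟨y :: w, rfl⟩)
  | node l r ihl ihr =>
    intro w
    have h1 := hN.br_mem_leftNormedSpan x ihr _ (ihl w)
    have h2 := hN.br_mem_leftNormedSpan x ihl _ (ihr w)
    rw [Finsupp.mapDomain_single] at h1 h2
    have h3 := Submodule.mem_sup_left (T := Submodule.span k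
      (Set.range fun w => Finsupp.single (leftNormed x w) 1)) (hN.jacobi (leftNormed x w) l r)
    convert sub_mem (sub_mem h1 h2) h3 using 1
    abel

/-- The induction follows `x` down the tree; antisymmetry moves the subtree containing `x` to the
left. -/
theorem IsRelationSpace.mem_leftNormedSpan (t : CTree lieSig (col X) ()) (ht : x ∈ t.leaves) :
    Finsupp.single t 1 ∈ leftNormedSpan N x := by
  induction t using tree_induction with
  | leaf y =>
    obtain rfl : x = y := by simpa [inp, CTree.leaves] using ht
    exact Submodule.mem_sup_right (Submodule.subset_span ⟨[], rfl⟩)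
  | node l r ihl ihr =>
    rcases List.mem_append.1 ht with h | h
    · have := hN.br_mem_leftNormedSpan x (hN.leftNormed_br_mem x r) _ (ihl h)
      rwa [Finsupp.mapDomain_single] at this
    · have h1 := hN.br_mem_leftNormedSpan x (hN.leftNormed_br_mem x l) _ (ihr h)
      rw [Finsupp.mapDomain_single] at h1
      have h2 := Submodule.mem_sup_left (T := Submodule.span k
        (Set.range fun w => Finsupp.single (leftNormed x w) 1)) (hN.antisymm l r)
      exact (congrArg (· ∈ leftNormedSpan N x) (add_sub_cancel_right _ _)).mp (sub_mem h2 h1)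

/-- Left-normed brackets with first entry `x` in which every label occurs once. -/
abbrev LeftNormedMonomial (x : X) : Type := {w : List X // (leftNormed x w).IsLinear}

omit hN in
theorem LeftNormedMonomial.notMem {x : X} (w : LeftNormedMonomial x) : x ∉ w.1 := by
  have h := w.2.1
  rw [leaves_leftNormed, List.nodup_cons, List.mem_reverse] at h
  exact h.1

/-- A left-normed bracket as an element of the free operad. -/
noncomputable def LeftNormedMonomial.toFreeOp {x : X} (k : Type u) [Field k]
    (w : LeftNormedMonomial x) : FreeOp k lieSig (col X) () :=
  mono k (leftNormed x w.1) w.2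

/-- The relation space is left abstract because the lemma is used twice: for the ideal of `Lie`, and
for the ideal of `MLie` pulled back to uncoloured trees. -/
theorem IsRelationSpace.eq_ker_and_bijective (N₀ : Submodule k (FreeOp k lieSig (col X) ()))
    (h₀ : ∀ q ∈ N, linearPart k (col X) () q ∈ N₀)
    (h₁ : N₀ ≤ LinearMap.ker (FreeOp.assoc (fun _ => 1) (fun _ => -1) (col X) ())) :
    N₀ = LinearMap.ker (FreeOp.assoc (fun _ => 1) (fun _ => -1) (col X) ()) ∧
      Function.Bijective (N₀.mkQ ∘ₗ Finsupp.linearCombination k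
        (LeftNormedMonomial.toFreeOp (x := x) k)) := by
  refine eq_ker_and_bijective_of_linearIndependent _ N₀ h₁ _ ?_ ?_
  · rw [eq_top_iff]
    intro p _
    induction p using Finsupp.induction_linear with
    | zero => exact zero_mem _
    | add p q hp hq => exact add_mem (hp trivial) (hq trivial)
    | single t r =>
      rw [← mul_one r, ← smul_eq_mul, ← Finsupp.smul_single, ← linearPart_single]
      refine Submodule.smul_mem _ _ ?_
      refine (sup_le (a := N) (c := (N₀ ⊔ Submodule.span k (Set.range
        (LeftNormedMonomial.toFreeOp (x := x) k))).comap (linearPart k (col X) ())) ?_ ?_)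
        (hN.mem_leftNormedSpan x t.1 (t.2.2 x))
      · exact fun q hq => Submodule.mem_sup_left (h₀ q hq)
      · rw [Submodule.span_le]
        rintro _ ⟨w, rfl⟩
        rw [SetLike.mem_coe, Submodule.mem_comap]
        by_cases hw : (leftNormed x w).IsLinear
        · exact Submodule.mem_sup_right (Submodule.subset_span
            ⟨⟨w, hw⟩, (linearPart_single ⟨leftNormed x w, hw⟩ 1).symm⟩)
        · rw [linearPart_single_of_not _ _ hw]
          exact zero_mem _
  · have h := (linearIndependent_commutator_leftNormed (k := k) x).comp
      (fun w : LeftNormedMonomial x => ⟨w.1, w.notMem⟩)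
      (fun w w' h => Subtype.ext (congrArg (fun v => v.1) h))
    convert h using 1
    · funext w
      exact FreeOp.assoc_mono _ _ _ _
    · rfl

end Span

end Lie

theorem TreeMonomial.isEmpty_of_isEmpty {I : Type} {S : BinarySignature I} {X : Type} [IsEmpty X]
    {χ : X → I} {c : I} : IsEmpty (TreeMonomial S χ c) := by
  refine ⟨fun t => ?_⟩
  have h : ∀ {c : I} (t : CTree S χ c), False := fun t => by
    induction t with
    | leaf x h => exact isEmptyElim x
    | node g h l r ihl ihr => exact ihl
  exact h t.1

/-- Substitution of trees for the inputs of an operation of the free operad. -/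
noncomputable def FreeOp.bind {k : Type u} [Field k] {I : Type} {S : BinarySignature I}
    {X Y : Type} {χ : X → I} {χ' : Y → I} {c : I}
    (f : ∀ (y : Y) (c : I), χ' y = c → CTree S χ c) : FreeOp k S χ' c →ₗ[k] (CTree S χ c →₀ k) :=
  Finsupp.lmapDomain k k fun t => t.1.bind f

theorem FreeOp.bind_mono {k : Type u} [Field k] {I : Type} {S : BinarySignature I}
    {X Y : Type} {χ : X → I} {χ' : Y → I} {c : I}
    (f : ∀ (y : Y) (c : I), χ' y = c → CTree S χ c) (t : CTree S χ' c) (h : t.IsLinear) :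
    FreeOp.bind f (mono k t h) = Finsupp.single (t.bind f) 1 :=
  Finsupp.mapDomain_single

theorem OperadIdeal.generate_bind_mem_rawSpan {k : Type u} [Field k] {I : Type}
    {S : BinarySignature I} {X Y : Type} [Finite Y] {χ : X → I} {χ' : Y → I} {c : I}
    {R : ∀ (X : Type) [Finite X] (χ : X → I) (c : I), Set (FreeOp k S χ c)}
    (f : ∀ (y : Y) (c : I), χ' y = c → CTree S χ c) (p : FreeOp k S χ' c) (hp : p ∈ R Y χ' c) :
    FreeOp.bind f p ∈ (OperadIdeal.generate R).rawSpan χ c :=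
  OperadIdeal.bind_mem_rawSpan _ f p (OperadIdeal.subset_generate R Y χ' c hp)

/-! ### The ideal of `Lie` as a kernel -/

namespace Lie

variable (k : Type u) [Field k]

/-- The ideal of relations of `Lie`. -/
noncomputable abbrev ideal : OperadIdeal k lieSig :=
  OperadIdeal.generate (fun X _ χ c => {p | Rel k X χ c p})

variable {k} in
theorem commutator_antisymm {X : Type} (a b : CTree lieSig (col X) ()) :
    commutator k (br a b) + commutator k (br b a) = 0 := by
  simp only [commutator_br]
  noncomm_ring

variable {k} in
theorem commutator_jacobi {X : Type} (a b c : CTree lieSig (col X) ()) :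
    commutator k (br (br a b) c) - commutator k (br (br a c) b)
      - commutator k (br a (br b c)) = 0 := by
  simp only [commutator_br]
  noncomm_ring

theorem ideal_le (X : Type) [Finite X] : (ideal k).carrier X (col X) () ≤
    LinearMap.ker (FreeOp.assoc (fun _ => 1) (fun _ => -1) (col X) ()) := by
  refine OperadIdeal.generate_le _ (assocIdeal (fun _ => 1) (fun _ => -1)) ?_ X (col X) ()
  rintro X _ χ c p (_ | _)
  · refine (mem_assocIdeal _ _ _).2 ?_
    rw [map_add, FreeOp.assoc_mono, FreeOp.assoc_mono]
    exact commutator_antisymm _ _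
  · refine (mem_assocIdeal _ _ _).2 ?_
    rw [map_sub, map_sub, FreeOp.assoc_mono, FreeOp.assoc_mono, FreeOp.assoc_mono]
    exact commutator_jacobi _ _ _

theorem isRelationSpace_rawSpan (X : Type) :
    IsRelationSpace ((ideal k).rawSpan (col X) ()) where
  br_left q hq r := (ideal k).node_left_mem_rawSpan LieGen.β rfl r q hq
  antisymm a b := by
    have h := OperadIdeal.generate_bind_mem_rawSpan
      (R := fun X _ χ c => {p | Rel k X χ c p}) (χ := col X) (fun i _ _ => ![a, b] i) _
      Rel.antisymm
    rw [map_add, FreeOp.bind_mono, FreeOp.bind_mono] at h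
    exact h
  jacobi a b c := by
    have h := OperadIdeal.generate_bind_mem_rawSpan
      (R := fun X _ χ c => {p | Rel k X χ c p}) (χ := col X) (fun i _ _ => ![a, b, c] i) _
      Rel.jacobi
    rw [map_sub, map_sub, FreeOp.bind_mono, FreeOp.bind_mono, FreeOp.bind_mono] at h
    exact h

theorem ideal_eq_ker_and_bijective {X : Type} [Finite X] (x : X) :
    (ideal k).carrier X (col X) () =
        LinearMap.ker (FreeOp.assoc (fun _ => 1) (fun _ => -1) (col X) ()) ∧
      Function.Bijective (((ideal k).carrier X (col X) ()).mkQ ∘ₗ Finsupp.linearCombination k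
        (LeftNormedMonomial.toFreeOp (x := x) k)) :=
  (isRelationSpace_rawSpan k X).eq_ker_and_bijective x _
    (fun q hq => (ideal k).linearPart_mem q hq) (ideal_le k X)

theorem ideal_eq_ker (X : Type) [Finite X] : (ideal k).carrier X (col X) () =
    LinearMap.ker (FreeOp.assoc (fun _ => 1) (fun _ => -1) (col X) ()) := by
  rcases isEmpty_or_nonempty X with h | ⟨⟨x⟩⟩
  · have := TreeMonomial.isEmpty_of_isEmpty (S := lieSig) (χ := col X) (c := ())
    exact Subsingleton.elim _ _
  · exact (ideal_eq_ker_and_bijective k x).1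

end Lie

/-! ### The relations of `MLie` and their evaluation -/

namespace MLie

variable (k : Type u) [Field k]

/-- The ideal of relations of `MLie`. -/
noncomputable abbrev ideal : OperadIdeal k mlieSig :=
  OperadIdeal.generate (fun X _ χ c => {p | Rel k X χ c p})

/-- The generator `β` acts on the free associative algebra by commutators and `d` by
multiplication; this is the coefficient of the opposite product. -/
def oppCoeff : mlieSig.Gen → k
  | .β => -1
  | .d => 0

variable {X Y : Type} {χ : X → Colour}

/-- The evaluation of trees in the free associative algebra. -/
noncomputable abbrev eval {c : Colour} : CTree mlieSig χ c → FreeAlgebra k X :=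
  CTree.assoc (fun _ => 1) (oppCoeff k)

variable {k} in
theorem eval_br (l r : CTree mlieSig χ .second) :
    eval k (br l r) = eval k l * eval k r - eval k r * eval k l :=
  (congrArg₂ (· + ·) (one_smul k _) (neg_one_smul k _)).trans (sub_eq_add_neg _ _).symm

variable {k} in
theorem eval_act (l : CTree mlieSig χ .second) (m : CTree mlieSig χ .first) :
    eval k (act l m) = eval k l * eval k m :=
  (congrArg₂ (· + ·) (one_smul k _) (zero_smul k _)).trans (add_zero _)

variable {k} in
theorem eval_antisymm (a b : CTree mlieSig χ .second) :
    eval k (br a b) + eval k (br b a) = 0 := by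
  rw [eval_br, eval_br]
  noncomm_ring

variable {k} in
theorem eval_jacobi (a b c : CTree mlieSig χ .second) :
    eval k (br (br a b) c) - eval k (br (br a c) b) - eval k (br a (br b c)) = 0 := by
  rw [eval_br, eval_br, eval_br, eval_br, eval_br, eval_br]
  noncomm_ring

variable {k} in
theorem eval_module (a b : CTree mlieSig χ .second) (m : CTree mlieSig χ .first) :
    eval k (act (br a b) m) - eval k (act a (act b m)) + eval k (act b (act a m)) = 0 := by
  rw [eval_act, eval_act, eval_act, eval_act, eval_act, eval_br]
  noncomm_ring

theorem ideal_le (X : Type) [Finite X] (χ : X → Colour) (c : Colour) :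
    (ideal k).carrier X χ c ≤ LinearMap.ker (FreeOp.assoc (fun _ => 1) (oppCoeff k) χ c) := by
  refine OperadIdeal.generate_le _ (assocIdeal (fun _ => 1) (oppCoeff k)) ?_ X χ c
  rintro X _ χ c p (_ | _ | _)
  · refine (mem_assocIdeal _ _ _).2 ?_
    rw [map_add, FreeOp.assoc_mono, FreeOp.assoc_mono]
    exact eval_antisymm _ _
  · refine (mem_assocIdeal _ _ _).2 ?_
    rw [map_sub, map_sub, FreeOp.assoc_mono, FreeOp.assoc_mono, FreeOp.assoc_mono]
    exact eval_jacobi _ _ _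
  · refine (mem_assocIdeal _ _ _).2 ?_
    rw [map_add, map_sub, FreeOp.assoc_mono, FreeOp.assoc_mono, FreeOp.assoc_mono]
    exact eval_module _ _ _

/-- The output colour is an index of the family of trees, so the induction runs over all colours and
carries an equation for the colour; this equation excludes `d` at the root. -/
theorem second_induction {P : CTree mlieSig χ .second → Prop}
    (leaf : ∀ x h, P (.leaf x h)) (node : ∀ l r, P l → P r → P (br l r))
    (t : CTree mlieSig χ .second) : P t := by
  have h : ∀ {c : Colour} (t : CTree mlieSig χ c) (hc : c = .second), P (hc ▸ t) :=
    fun {c} t => by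
      induction t with
      | leaf x h =>
        rintro rfl
        exact leaf x h
      | node g h l r ihl ihr =>
        rintro rfl
        cases g with
        | β => exact node l r (ihl rfl) (ihr rfl)
        | d => cases h
  exact h t rfl

theorem first_induction {P : CTree mlieSig χ .first → Prop}
    (leaf : ∀ x h, P (.leaf x h)) (node : ∀ l m, P m → P (act l m))
    (t : CTree mlieSig χ .first) : P t := by
  have h : ∀ {c : Colour} (t : CTree mlieSig χ c) (hc : c = .first), P (hc ▸ t) :=
    fun {c} t => by
      induction t with
      | leaf x h =>
        rintro rfl
        exact leaf x h
      | node g h l r ihl ihr =>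
        rintro rfl
        cases g with
        | β => cases h
        | d => exact node l r (ihr rfl)
  exact h t rfl

theorem antisymm_mem_rawSpan (a b : CTree mlieSig χ .second) :
    Finsupp.single (br a b) 1 + Finsupp.single (br b a) 1 ∈ (ideal k).rawSpan χ .second := by
  have h := OperadIdeal.generate_bind_mem_rawSpan
      (R := fun X _ χ c => {p | Rel k X χ c p}) (χ := χ) (fun i c h => h ▸ ![a, b] i) _
    Rel.antisymm
  rw [map_add, FreeOp.bind_mono, FreeOp.bind_mono] at h
  exact h

theorem jacobi_mem_rawSpan (a b c : CTree mlieSig χ .second) :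
    Finsupp.single (br (br a b) c) 1 - Finsupp.single (br (br a c) b) 1
      - Finsupp.single (br a (br b c)) 1 ∈ (ideal k).rawSpan χ .second := by
  have h := OperadIdeal.generate_bind_mem_rawSpan
      (R := fun X _ χ c => {p | Rel k X χ c p}) (χ := χ) (fun i _ h => h ▸ ![a, b, c] i) _
    Rel.jacobi
  rw [map_sub, map_sub, FreeOp.bind_mono, FreeOp.bind_mono, FreeOp.bind_mono] at h
  exact h

theorem module_mem_rawSpan (a b : CTree mlieSig χ .second) (m : CTree mlieSig χ .first) :
    Finsupp.single (act (br a b) m) 1 - Finsupp.single (act a (act b m)) 1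
      + Finsupp.single (act b (act a m)) 1 ∈ (ideal k).rawSpan χ .first := by
  have h := OperadIdeal.generate_bind_mem_rawSpan
      (R := fun X _ χ c => {p | Rel k X χ c p}) (χ := χ) (fun i _ h => match i, h with
      | 0, h => h ▸ a
      | 1, h => h ▸ b
      | 2, h => h ▸ m) _
    Rel.module
  rw [map_add, map_sub, FreeOp.bind_mono, FreeOp.bind_mono, FreeOp.bind_mono] at h
  exact h

/-! #### Operations with output of the second colour -/

/-- The tree of the operad `Lie` obtained by forgetting the colours. -/
def forget {X : Type} {χ : X → Colour} :
    {c : Colour} → CTree mlieSig χ c → CTree lieSig (Lie.col X) ()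
  | _, .leaf x _ => Lie.inp x
  | _, .node _ _ l r => Lie.br (forget l) (forget r)

theorem leaves_forget {c : Colour} (t : CTree mlieSig χ c) : (forget t).leaves = t.leaves := by
  induction t with
  | leaf x h => rfl
  | node g h l r ihl ihr => exact congrArg₂ (· ++ ·) ihl ihr

theorem forget_map {χ' : Y → Colour} {c : Colour} (f : X → Y) (hf : ∀ x, χ' (f x) = χ x)
    (t : CTree mlieSig χ c) :
    forget (t.map f hf) = (forget t).map (χ' := Lie.col Y) f (fun _ => rfl) := by
  induction t with
  | leaf x h => rfl
  | node g h l r ihl ihr => exact congrArg₂ Lie.br ihl ihr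

/-- Trees of the operad `Lie` as trees of the operad `MLie`. -/
def ofLie {X : Type} {χ : X → Colour} (h : ∀ x, χ x = .second) :
    {c : Unit} → CTree lieSig (Lie.col X) c → CTree mlieSig χ .second
  | _, .leaf x _ => .leaf x (h x)
  | _, .node _ _ l r => br (ofLie h l) (ofLie h r)

theorem forget_ofLie (h : ∀ x, χ x = .second) (t : CTree lieSig (Lie.col X) ()) :
    forget (ofLie h t) = t := by
  induction t using Lie.tree_induction with
  | leaf x => rfl
  | node l r ihl ihr => exact congrArg₂ Lie.br ihl ihr

theorem ofLie_forget (h : ∀ x, χ x = .second) (t : CTree mlieSig χ .second) :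
    ofLie h (forget t) = t := by
  induction t using second_induction with
  | leaf x => rfl
  | node l r ihl ihr => exact congrArg₂ br ihl ihr

theorem leaves_ofLie (h : ∀ x, χ x = .second) (t : CTree lieSig (Lie.col X) ()) :
    (ofLie h t).leaves = t.leaves := by
  rw [← leaves_forget, forget_ofLie]

theorem eval_eq_commutator_forget (t : CTree mlieSig χ .second) :
    eval k t = Lie.commutator k (forget t) := by
  induction t using second_induction with
  | leaf x => rfl
  | node l r ihl ihr =>
    rw [eval_br, ihl, ihr, ← Lie.commutator_br]
    rfl

theorem colour_of_mem_leaves (t : CTree mlieSig χ .second) (x : X) (hx : x ∈ t.leaves) :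
    χ x = .second := by
  induction t using second_induction with
  | leaf y h =>
    obtain rfl : x = y := by simpa [CTree.leaves] using hx
    exact h
  | node l r ihl ihr => exact (List.mem_append.1 hx).elim ihl ihr

theorem isEmpty_treeMonomial_second (h : ¬ ∀ x, χ x = .second) :
    IsEmpty (TreeMonomial mlieSig χ .second) :=
  ⟨fun t => h fun x => colour_of_mem_leaves t.1 x (t.2.2 x)⟩

/-- The tree monomial of `Lie` obtained by forgetting the colours. -/
def forgetMonomial (t : TreeMonomial mlieSig χ .second) : TreeMonomial lieSig (Lie.col X) () :=
  ⟨forget t.1, by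
    rw [CTree.IsLinear, leaves_forget]
    exact t.2⟩

/-- Tree monomials of `Lie` as tree monomials of `MLie`. -/
def ofLieMonomial (h : ∀ x, χ x = .second) (t : TreeMonomial lieSig (Lie.col X) ()) :
    TreeMonomial mlieSig χ .second :=
  ⟨ofLie h t.1, by
    rw [CTree.IsLinear, leaves_ofLie]
    exact t.2⟩

variable (χ) in
/-- The operation of the free operad on `β` obtained by forgetting the colours. -/
noncomputable def forgetOp :
    FreeOp k mlieSig χ .second →ₗ[k] FreeOp k lieSig (Lie.col X) () :=
  Finsupp.lmapDomain k k forgetMonomial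

/-- Operations of the free operad on `β` as operations of the free operad on `β` and `d`. -/
noncomputable def ofLieOp (h : ∀ x, χ x = .second) :
    FreeOp k lieSig (Lie.col X) () →ₗ[k] FreeOp k mlieSig χ .second :=
  Finsupp.lmapDomain k k (ofLieMonomial h)

theorem forgetOp_single (t : TreeMonomial mlieSig χ .second) (r : k) :
    forgetOp k χ (Finsupp.single t r) = Finsupp.single (forgetMonomial t) r :=
  Finsupp.mapDomain_single

theorem ofLieOp_single (h : ∀ x, χ x = .second) (t : TreeMonomial lieSig (Lie.col X) ())
    (r : k) : ofLieOp k h (Finsupp.single t r) = Finsupp.single (ofLieMonomial h t) r :=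
  Finsupp.mapDomain_single

theorem forgetOp_ofLieOp (h : ∀ x, χ x = .second) (p : FreeOp k lieSig (Lie.col X) ()) :
    forgetOp k χ (ofLieOp k h p) = p := by
  refine LinearMap.congr_fun (f := forgetOp k χ ∘ₗ ofLieOp k h) (g := LinearMap.id) ?_ p
  refine Finsupp.lhom_ext fun t r => ?_
  have e : forgetMonomial (ofLieMonomial h t) = t := Subtype.ext (forget_ofLie h t.1)
  rw [LinearMap.comp_apply, ofLieOp_single, forgetOp_single, e, LinearMap.id_apply]

theorem ofLieOp_forgetOp (h : ∀ x, χ x = .second) (p : FreeOp k mlieSig χ .second) :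
    ofLieOp k h (forgetOp k χ p) = p := by
  refine LinearMap.congr_fun (f := ofLieOp k h ∘ₗ forgetOp k χ) (g := LinearMap.id) ?_ p
  refine Finsupp.lhom_ext fun t r => ?_
  have e : ofLieMonomial h (forgetMonomial t) = t := Subtype.ext (ofLie_forget h t.1)
  rw [LinearMap.comp_apply, forgetOp_single, ofLieOp_single, e, LinearMap.id_apply]

theorem assoc_forgetOp (p : FreeOp k mlieSig χ .second) :
    FreeOp.assoc (fun _ => 1) (fun _ => -1) (Lie.col X) () (forgetOp k χ p) =
      FreeOp.assoc (fun _ => 1) (oppCoeff k) χ .second p := by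
  refine LinearMap.congr_fun
    (f := FreeOp.assoc (fun _ => 1) (fun _ => -1) (Lie.col X) () ∘ₗ forgetOp k χ) ?_ p
  refine Finsupp.lhom_ext fun t r => ?_
  rw [LinearMap.comp_apply, forgetOp_single, FreeOp.assoc_single, FreeOp.assoc_single]
  exact congrArg (r • ·) (eval_eq_commutator_forget k t.1).symm

/-- This makes the left-normed rewriting available modulo the ideal of `MLie`, without a separate
argument for coloured trees. -/
theorem isRelationSpace_comap (h : ∀ x, χ x = .second) :
    Lie.IsRelationSpace (((ideal k).rawSpan χ .second).comap
      (Finsupp.lmapDomain k k (ofLie h (c := ())))) where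
  br_left q hq r := by
    rw [Submodule.mem_comap, Finsupp.lmapDomain_apply] at hq ⊢
    have := (ideal k).node_left_mem_rawSpan (c := .second) MLieGen.β rfl (ofLie h r) _ hq
    have e := Finsupp.mapDomain_comp (v := q) (f := ofLie (c := ()) h) (g := (br · (ofLie h r)))
    have e' := Finsupp.mapDomain_comp (v := q) (f := (Lie.br · r)) (g := ofLie (c := ()) h)
    exact (congrArg (· ∈ (ideal k).rawSpan χ .second) (e.symm.trans e')).mp this
  antisymm a b := by
    rw [Submodule.mem_comap, map_add]
    simp only [Finsupp.lmapDomain_apply, Finsupp.mapDomain_single]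
    exact antisymm_mem_rawSpan k (ofLie h a) (ofLie h b)
  jacobi a b c := by
    rw [Submodule.mem_comap, map_sub, map_sub]
    simp only [Finsupp.lmapDomain_apply, Finsupp.mapDomain_single]
    exact jacobi_mem_rawSpan k (ofLie h a) (ofLie h b) (ofLie h c)

theorem linearPart_ofLie (h : ∀ x, χ x = .second) (q : CTree lieSig (Lie.col X) () →₀ k) :
    linearPart k χ .second (mapDomain (ofLie h) q) =
      ofLieOp k h (linearPart k (Lie.col X) () q) := by
  refine LinearMap.congr_fun (f := linearPart k χ .second ∘ₗ Finsupp.lmapDomain k k (ofLie h))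
    (g := ofLieOp k h ∘ₗ linearPart k (Lie.col X) ()) ?_ q
  refine Finsupp.lhom_ext fun t r => ?_
  simp only [LinearMap.comp_apply, Finsupp.lmapDomain_apply, Finsupp.mapDomain_single]
  have hl : (ofLie h t).IsLinear ↔ t.IsLinear := by
    rw [CTree.IsLinear, CTree.IsLinear, leaves_ofLie]
  by_cases ht : t.IsLinear
  · have e := linearPart_single (⟨t, ht⟩ : TreeMonomial lieSig (Lie.col X) ()) r
    refine (linearPart_single (ofLieMonomial h ⟨t, ht⟩) r).trans ?_
    exact (ofLieOp_single k h ⟨t, ht⟩ r).symm.trans (congrArg (ofLieOp k h) e.symm)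
  · rw [linearPart_single_of_not _ _ ht, linearPart_single_of_not _ _ (mt hl.1 ht), map_zero]

/-- Both ideals are the kernel of the same evaluation, because forgetting colours does not change
the value of a tree. If some input has the first colour, there is no tree at all. -/
theorem mem_ideal_second [Finite X] (p : FreeOp k mlieSig χ .second) :
    p ∈ (ideal k).carrier X χ .second ↔
      forgetOp k χ p ∈ (Lie.ideal k).carrier X (Lie.col X) () := by
  rw [Lie.ideal_eq_ker, LinearMap.mem_ker, assoc_forgetOp]
  refine ⟨fun hp => ideal_le k X χ .second hp, fun hp => ?_⟩
  by_cases h : ∀ x, χ x = .second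
  · rcases isEmpty_or_nonempty X with _ | ⟨⟨x⟩⟩
    · have := TreeMonomial.isEmpty_of_isEmpty (S := mlieSig) (χ := χ) (c := .second)
      rw [Subsingleton.elim p 0]
      exact zero_mem _
    · have h1 := ((isRelationSpace_comap k h).eq_ker_and_bijective x
        (((ideal k).carrier X χ .second).comap (ofLieOp k h)) ?_ ?_).1
      · rw [← assoc_forgetOp, ← LinearMap.mem_ker, ← h1, Submodule.mem_comap,
          ofLieOp_forgetOp] at hp
        exact hp
      · intro q hq
        rw [Submodule.mem_comap, ← linearPart_ofLie]
        exact (ideal k).linearPart_mem _ hq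
      · intro q hq
        have := ideal_le k X χ .second hq
        rwa [LinearMap.mem_ker, ← assoc_forgetOp, forgetOp_ofLieOp] at this
  · have := isEmpty_treeMonomial_second h
    rw [Subsingleton.elim p 0]
    exact zero_mem _

/-! #### Operations with output of the first colour -/

/-- Trees of the operad `F(d)` as trees of the operad `MLie`. -/
def ofD {X : Type} {χ : X → Colour} : {c : Colour} → CTree dSig χ c → CTree mlieSig χ c
  | _, .leaf x h => .leaf x h
  | _, .node _ h l r => .node MLieGen.d h (ofD l) (ofD r)

theorem leaves_ofD {c : Colour} (t : CTree dSig χ c) : (ofD t).leaves = t.leaves := by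
  induction t with
  | leaf x h => rfl
  | node g h l r ihl ihr => exact congrArg₂ (· ++ ·) ihl ihr

theorem ofD_map {χ' : Y → Colour} {c : Colour} (f : X → Y) (hf : ∀ x, χ' (f x) = χ x)
    (t : CTree dSig χ c) : ofD (t.map f hf) = (ofD t).map f hf := by
  induction t with
  | leaf x h => rfl
  | node g h l r ihl ihr => exact congrArg₂ (CTree.node MLieGen.d h) ihl ihr

theorem eval_ofD {c : Colour} (t : CTree dSig χ c) : eval k (ofD t) = word k t.leaves := by
  induction t with
  | leaf x h => exact (word_singleton k x).symm
  | node g h l r ihl ihr =>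
    rw [CTree.leaves, word_append, ← ihl, ← ihr]
    exact (congrArg₂ (· + ·) (one_smul k _) (zero_smul k _)).trans (add_zero _)

end MLie

theorem dTree_second (X : Type) (χ : X → Colour) (t : CTree dSig χ .second) :
    ∃ x h, t = .leaf x h := by
  cases t with
  | leaf x h => exact ⟨x, h, rfl⟩
  | node g h l r => cases h

theorem CTree.leaves_ne_nil {I : Type} {S : BinarySignature I} {X : Type} {χ : X → I} {c : I}
    (t : CTree S χ c) : t.leaves ≠ [] := by
  induction t with
  | leaf x h => simp [leaves]
  | node g h l r ihl ihr => simp [leaves, ihl]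

/-- The first input of `d` has the second colour, which no generator of F(d) outputs, so it is
always a leaf. Every tree is therefore a right comb, recovered from its leaves. -/
theorem dTree_leaves_injective {X : Type} {χ : X → Colour} {c : Colour} :
    Function.Injective (CTree.leaves : CTree dSig χ c → List X) := by
  intro t
  induction t with
  | leaf x h =>
    intro t' ht
    cases t' with
    | leaf x' h' =>
      obtain rfl : x = x' := by simpa [CTree.leaves] using ht
      rfl
    | node g' h' l' r' =>
      obtain ⟨y, hy, rfl⟩ := dTree_second X χ l'
      exact absurd (List.cons.inj ht).2.symm r'.leaves_ne_nil
  | node g h l r ihl ihr =>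
    intro t' ht
    obtain ⟨x, hx, rfl⟩ := dTree_second X χ l
    cases t' with
    | leaf x' h' => exact absurd (List.cons.inj ht).2 r.leaves_ne_nil
    | node g' h' l' r' =>
      obtain ⟨y, hy, rfl⟩ := dTree_second X χ l'
      obtain ⟨h1, h2⟩ := List.cons.inj ht
      subst h1
      obtain rfl := ihr h2
      cases g
      cases g'
      rfl

namespace MLie

variable (k : Type u) [Field k] {X Y : Type} {χ : X → Colour}

variable (χ) in
/-- The span of the trees of `F(d)` modulo the relations of `MLie`. -/
noncomputable def ofDSpan : Submodule k (CTree mlieSig χ .first →₀ k) :=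
  (ideal k).rawSpan χ .first ⊔
    Submodule.span k (Set.range fun t : CTree dSig χ .first => Finsupp.single (ofD t) 1)

variable {k} in
theorem act_mem_ofDSpan {l : CTree mlieSig χ .second}
    (hl : ∀ u : CTree dSig χ .first, Finsupp.single (act l (ofD u)) 1 ∈ ofDSpan k χ)
    (q : CTree mlieSig χ .first →₀ k) (hq : q ∈ ofDSpan k χ) :
    mapDomain (act l) q ∈ ofDSpan k χ := by
  refine (sup_le (a := (ideal k).rawSpan χ .first) (c := (ofDSpan k χ).comap
    (Finsupp.lmapDomain k k (act l))) ?_ ?_) hq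
  · exact fun q hq => Submodule.mem_sup_left
      ((ideal k).node_right_mem_rawSpan (c := .first) MLieGen.d rfl l q hq)
  · rw [Submodule.span_le]
    rintro _ ⟨w, rfl⟩
    simpa using hl w

/-- The module relation replaces d([a,b],u) by d(a,d(b,u)) - d(b,d(a,u)). Acting with b gives a
combination of trees of F(d), to which the hypothesis for a then applies; hence all `u` at once. -/
theorem act_ofD_mem (l : CTree mlieSig χ .second) :
    ∀ u : CTree dSig χ .first, Finsupp.single (act l (ofD u)) 1 ∈ ofDSpan k χ := by
  induction l using second_induction with
  | leaf x h =>
    exact fun u => Submodule.mem_sup_right (Submodule.subset_span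
      ⟨.node DGen.d rfl (.leaf x h) u, rfl⟩)
  | node a b iha ihb =>
    intro u
    have h1 := act_mem_ofDSpan iha _ (ihb u)
    have h2 := act_mem_ofDSpan ihb _ (iha u)
    rw [Finsupp.mapDomain_single] at h1 h2
    have h3 : _ ∈ ofDSpan k χ := Submodule.mem_sup_left (module_mem_rawSpan k a b (ofD u))
    convert sub_mem (add_mem h3 h1) h2 using 1
    abel

theorem mem_ofDSpan (t : CTree mlieSig χ .first) : Finsupp.single t 1 ∈ ofDSpan k χ := by
  induction t using first_induction with
  | leaf x h => exact Submodule.mem_sup_right (Submodule.subset_span ⟨.leaf x h, rfl⟩)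
  | node l m ih =>
    have := act_mem_ofDSpan (act_ofD_mem k l) _ ih
    rwa [Finsupp.mapDomain_single] at this

/-- Tree monomials of `F(d)` as tree monomials of `MLie`. -/
def ofDMonomial (t : TreeMonomial dSig χ .first) : TreeMonomial mlieSig χ .first :=
  ⟨ofD t.1, by
    rw [CTree.IsLinear, leaves_ofD]
    exact t.2⟩

/-- Trees of F(d) span modulo the relations by `mem_ofDSpan`, and they evaluate to pairwise distinct
words. -/
theorem bijective_ofD [Finite X] :
    Function.Bijective (((ideal k).carrier X χ .first).mkQ ∘ₗ
      Finsupp.linearCombination k (fun t => Finsupp.single (ofDMonomial (χ := χ) t) (1 : k))) := by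
  refine (eq_ker_and_bijective_of_linearIndependent _ _
    (ideal_le k X χ .first) _ ?_ ?_).2
  · rw [eq_top_iff]
    intro p _
    induction p using Finsupp.induction_linear with
    | zero => exact zero_mem _
    | add p q hp hq => exact add_mem (hp trivial) (hq trivial)
    | single t r =>
      rw [← mul_one r, ← smul_eq_mul, ← Finsupp.smul_single, ← linearPart_single]
      refine Submodule.smul_mem _ _ ?_
      refine (sup_le (a := (ideal k).rawSpan χ .first)
        (c := ((ideal k).carrier X χ .first ⊔ Submodule.span k (Set.range
        (fun t => Finsupp.single (ofDMonomial (χ := χ) t) 1))).comap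
          (linearPart k χ .first)) ?_ ?_) (mem_ofDSpan k t.1)
      · exact fun q hq => Submodule.mem_sup_left ((ideal k).linearPart_mem q hq)
      · rw [Submodule.span_le]
        rintro _ ⟨w, rfl⟩
        rw [SetLike.mem_coe, Submodule.mem_comap]
        by_cases hw : w.IsLinear
        · exact Submodule.mem_sup_right (Submodule.subset_span
            ⟨⟨w, hw⟩, (linearPart_single (ofDMonomial ⟨w, hw⟩) 1).symm⟩)
        · rw [linearPart_single_of_not]
          · exact zero_mem _
          · rwa [CTree.IsLinear, leaves_ofD]
  · have h := (linearIndependent_word k).comp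
      (fun w : TreeMonomial dSig χ .first => w.1.leaves)
      (fun w w' h => Subtype.ext (dTree_leaves_injective h))
    convert h using 1
    · funext w
      rw [FreeOp.assoc_single, one_smul]
      exact eval_ofD k w.1
    · rfl

end MLie

/-! ### The isomorphism -/

namespace MLie

variable (k : Type u) [Field k] {X Y : Type} {χ : X → Colour}

theorem forgetOp_res (e : X ≃ Y) (χ : Y → Colour) (p : FreeOp k mlieSig χ .second) :
    forgetOp k (χ ∘ e) (FreeOp.res e χ .second p) =
      FreeOp.res e (Lie.col Y) () (forgetOp k χ p) := by
  refine LinearMap.congr_fun (f := forgetOp k (χ ∘ e) ∘ₗ FreeOp.res e χ .second)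
    (g := FreeOp.res e (Lie.col Y) () ∘ₗ forgetOp k χ) ?_ p
  refine Finsupp.lhom_ext fun t r => ?_
  have e₁ : FreeOp.res e χ .second (Finsupp.single t r) =
    Finsupp.single (TreeMonomial.res e χ t) r := Finsupp.mapDomain_single
  have e₂ : FreeOp.res e (Lie.col Y) () (Finsupp.single (forgetMonomial t) r) =
    Finsupp.single (TreeMonomial.res e (Lie.col Y) (forgetMonomial t)) r :=
    Finsupp.mapDomain_single
  have e₃ : forgetMonomial (TreeMonomial.res e χ t) =
      TreeMonomial.res e (Lie.col Y) (forgetMonomial t) :=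
    Subtype.ext (forget_map (χ' := χ ∘ e) e.symm (fun y => by simp) t.1)
  rw [LinearMap.comp_apply, LinearMap.comp_apply, e₁, forgetOp_single, forgetOp_single, e₂, e₃]

/-- The map from operations of `MLie` with output of the second colour to operations of `Lie`. -/
noncomputable def toLie [Finite X] (χ : X → Colour) :
    (FreeOp k mlieSig χ .second ⧸ (ideal k).carrier X χ .second) →ₗ[k]
      (FreeOp k lieSig (Lie.col X) () ⧸ (Lie.ideal k).carrier X (Lie.col X) ()) :=
  Submodule.mapQ _ _ (forgetOp k χ) fun p hp => (mem_ideal_second k p).1 hp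

theorem toLie_injective [Finite X] (χ : X → Colour) : Function.Injective (toLie k χ) := by
  rw [injective_iff_map_eq_zero]
  intro y hy
  obtain ⟨p, rfl⟩ := Submodule.Quotient.mk_surjective _ y
  rw [toLie, Submodule.mapQ_apply, Submodule.Quotient.mk_eq_zero, ← mem_ideal_second] at hy
  exact (Submodule.Quotient.mk_eq_zero _).2 hy

theorem toLie_surjective [Finite X] (h : ∀ x, χ x = .second) :
    Function.Surjective (toLie k χ) := by
  intro y
  obtain ⟨p, rfl⟩ := Submodule.Quotient.mk_surjective _ y
  refine ⟨Submodule.Quotient.mk (ofLieOp k h p), ?_⟩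
  rw [toLie, Submodule.mapQ_apply, forgetOp_ofLieOp]

theorem bijective_pi_toLie [Finite X] (χ : X → Colour) : Function.Bijective
    (LinearMap.pi fun _ : PLift (∀ x, χ x = .second) => toLie k χ) := by
  by_cases h : ∀ x, χ x = .second
  · refine ⟨fun y z hyz => toLie_injective k χ (congrFun hyz ⟨h⟩), fun f => ?_⟩
    obtain ⟨y, hy⟩ := toLie_surjective k h (f ⟨h⟩)
    exact ⟨y, funext fun _ => hy⟩
  · have := isEmpty_treeMonomial_second h
    have : IsEmpty (PLift (∀ x, χ x = .second)) := ⟨fun h' => h h'.down⟩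
    refine ⟨fun y z _ => ?_, fun f => ⟨0, Subsingleton.elim _ _⟩⟩
    obtain ⟨p, rfl⟩ := Submodule.Quotient.mk_surjective _ y
    obtain ⟨q, rfl⟩ := Submodule.Quotient.mk_surjective _ z
    rw [Subsingleton.elim p q]

variable (χ) in
/-- Operations of `F(d)` as operations of `MLie`. -/
noncomputable def ofDOp [Finite X] : FreeOp k dSig χ .first →ₗ[k]
    (FreeOp k mlieSig χ .first ⧸ (ideal k).carrier X χ .first) :=
  ((ideal k).carrier X χ .first).mkQ ∘ₗ
    Finsupp.linearCombination k (fun t => Finsupp.single (ofDMonomial (χ := χ) t) (1 : k))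

theorem ofDOp_single [Finite X] (t : TreeMonomial dSig χ .first) (r : k) :
    ofDOp k χ (Finsupp.single t r) =
      Submodule.Quotient.mk (Finsupp.single (ofDMonomial t) r) := by
  rw [ofDOp, LinearMap.comp_apply, Finsupp.linearCombination_single, Finsupp.smul_single,
    smul_eq_mul, mul_one]
  rfl

theorem ofDOp_res [Finite X] [Finite Y] (e : X ≃ Y) (χ : Y → Colour)
    (p : FreeOp k dSig χ .first) :
    ofDOp k (χ ∘ e) (FreeOp.res e χ .first p) =
      (mlieOperad k).res e χ .first (ofDOp k χ p) := by
  refine LinearMap.congr_fun (f := ofDOp k (χ ∘ e) ∘ₗ FreeOp.res e χ .first)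
    (g := (Submodule.mapQ _ _ (FreeOp.res e χ .first)
      fun p hp => (ideal k).res_mem e χ .first p hp) ∘ₗ ofDOp k χ) ?_ p
  refine Finsupp.lhom_ext fun t r => ?_
  have e₁ : FreeOp.res e χ .first (Finsupp.single t r) =
    Finsupp.single (TreeMonomial.res e χ t) r := Finsupp.mapDomain_single
  have e₂ : FreeOp.res e χ .first (Finsupp.single (ofDMonomial t) r) =
    Finsupp.single (TreeMonomial.res e χ (ofDMonomial t)) r := Finsupp.mapDomain_single
  have e₃ : ofDMonomial (TreeMonomial.res e χ t) = TreeMonomial.res e χ (ofDMonomial t) :=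
    Subtype.ext (ofD_map (χ' := χ ∘ e) e.symm (fun y => by simp) t.1)
  rw [LinearMap.comp_apply, LinearMap.comp_apply, e₁, ofDOp_single, ofDOp_single,
    Submodule.mapQ_apply, e₂, e₃]

/-- The isomorphism of `F(d)` with the part of `MLie` with output of the first colour. -/
noncomputable def ofDEquiv [Finite X] (χ : X → Colour) : FreeOp k dSig χ .first ≃ₗ[k]
    (FreeOp k mlieSig χ .first ⧸ (ideal k).carrier X χ .first) :=
  LinearEquiv.ofBijective (ofDOp k χ) (bijective_ofD k)

/-- The components of the isomorphism `MLie ≃ (F(d), Lie)`. -/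
noncomputable def isoEquiv (X : Type) [Finite X] (χ : X → Colour) : ∀ c : Colour,
    (mlieOperad k).obj X χ c ≃ₗ[k] (pairCollection (freeD k) (lieOperad k)).obj X χ c
  | .first => (ofDEquiv k χ).symm
  | .second => LinearEquiv.ofBijective
      (LinearMap.pi fun _ : PLift (∀ x, χ x = .second) => toLie k χ) (bijective_pi_toLie k χ)

/-- The isomorphism of symmetric coloured collections `MLie ≃ (F(d), Lie)`. -/
noncomputable def iso : (mlieOperad k).Iso (pairCollection (freeD k) (lieOperad k)) where
  equiv X _ χ c := isoEquiv k X χ c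
  natural {X Y} _ _ e χ c p := by
    cases c with
    | first =>
      -- In this colour the isomorphism is an inverse, so naturality is transferred from the map out
      -- of F(d).
      obtain ⟨q, rfl⟩ := (ofDEquiv k χ).surjective p
      exact ((ofDEquiv k (χ ∘ e)).symm_apply_eq.2 (ofDOp_res k e χ q).symm).trans
        (congrArg (FreeOp.res e χ .first) ((ofDEquiv k χ).symm_apply_apply q).symm)
    | second =>
      obtain ⟨p, rfl⟩ := Submodule.Quotient.mk_surjective _ p
      funext h
      exact congrArg Submodule.Quotient.mk (forgetOp_res k e χ p)

end MLie

/-! ### Dimensions -/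

theorem colour_finsupp_ext_iff {m n : Colour →₀ ℕ} :
    m = n ↔ m .first = n .first ∧ m .second = n .second := by
  refine ⟨fun h => h ▸ ⟨rfl, rfl⟩, fun h => Finsupp.ext fun c => ?_⟩
  cases c
  exacts [h.1, h.2]

theorem colour_prod_eq {M : Type*} [CommMonoid M] (f : Colour → M) :
    ∏ i, f i = f .first * f .second :=
  Finset.prod_pair (by decide)

theorem colour_sum_eq {M : Type*} [AddCommMonoid M] (f : Colour → M) :
    ∑ i, f i = f .first + f .second :=
  Finset.sum_pair (by decide)

/-- Words in which every letter different from `y` occurs once and `y` does not occur. -/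
abbrev PuncturedWord {X : Type} (y : X) : Type := {w : List X // w.Nodup ∧ ∀ x, x ∈ w ↔ x ≠ y}

theorem card_puncturedWord {X : Type} [Fintype X] (y : X) :
    Nat.card (PuncturedWord y) = (Fintype.card X - 1).factorial := by
  classical
  have h : ∀ w : List X, (w.Nodup ∧ ∀ x, x ∈ w ↔ x ≠ y) ↔
      w ∈ ((Finset.univ.erase y).toList.permutations.toFinset : Set (List X)) := by
    intro w
    rw [List.coe_toFinset, Set.mem_ofPred_eq, List.mem_permutations]
    constructor
    · rintro ⟨h1, h2⟩
      rw [List.perm_ext_iff_of_nodup h1 (Finset.nodup_toList _)]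
      simp [h2]
    · intro h
      exact ⟨h.nodup_iff.2 (Finset.nodup_toList _), fun x => by simp [h.mem_iff]⟩
  rw [Nat.card_congr (Equiv.subtypeEquivRight h), Nat.card_coe_set_eq, Set.ncard_coe_finset,
    List.toFinset_card_of_nodup (List.nodup_permutations _ (Finset.nodup_toList _)),
    List.length_permutations, Finset.length_toList, Finset.card_erase_of_mem (Finset.mem_univ y),
    Finset.card_univ]

theorem finite_of_injective_leaves {X : Type} [Finite X] {W : Type} (f : W → List X)
    (hf : Function.Injective f) (h : ∀ w, (f w).Nodup) : Finite W := by
  classical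
  have := Fintype.ofFinite X
  exact Finite.of_injective (fun w => (⟨f w, h w⟩ : {l : List X // l.Nodup}))
    fun w w' h => hf (congrArg Subtype.val h)

instance {X : Type} [Finite X] (χ : X → Colour) : Finite (TreeMonomial dSig χ .first) :=
  finite_of_injective_leaves (fun t => t.1.leaves)
    (fun _ _ h => Subtype.ext (dTree_leaves_injective h)) fun t => t.2.1

namespace Lie

variable (k : Type u) [Field k] {X : Type}

theorem isLinear_leftNormed (x : X) (w : List X) :
    (leftNormed x w).IsLinear ↔ w.Nodup ∧ ∀ z, z ∈ w ↔ z ≠ x := by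
  rw [CTree.IsLinear, leaves_leftNormed]
  simp only [List.nodup_cons, List.mem_reverse, List.nodup_reverse, List.mem_cons]
  constructor
  · rintro ⟨⟨h1, h2⟩, h3⟩
    refine ⟨h2, fun z => ⟨?_, fun hz => (h3 z).resolve_left hz⟩⟩
    rintro hz rfl
    exact h1 hz
  · rintro ⟨h1, h2⟩
    refine ⟨⟨fun h => (h2 x).1 h rfl, h1⟩, fun z => ?_⟩
    rw [h2]
    exact em _

theorem card_leftNormedMonomial [Fintype X] (x : X) :
    Nat.card (LeftNormedMonomial x) = (Fintype.card X - 1).factorial := by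
  rw [← card_puncturedWord x]
  exact Nat.card_congr (Equiv.subtypeEquivRight (isLinear_leftNormed x))

instance [Finite X] (x : X) : Finite (LeftNormedMonomial x) :=
  finite_of_injective_leaves (fun w => w.1) Subtype.val_injective
    fun w => ((isLinear_leftNormed x w.1).1 w.2).1

/-- The basis of operations of `Lie` given by left-normed brackets. -/
noncomputable def leftNormedEquiv [Finite X] (x : X) : (LeftNormedMonomial x →₀ k) ≃ₗ[k]
    (FreeOp k lieSig (col X) () ⧸ (ideal k).carrier X (col X) ()) :=
  LinearEquiv.ofBijective _ (ideal_eq_ker_and_bijective k x).2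

theorem finiteDimensional [Finite X] : FiniteDimensional k
    (FreeOp k lieSig (col X) () ⧸ (ideal k).carrier X (col X) ()) := by
  rcases isEmpty_or_nonempty X with h | ⟨⟨x⟩⟩
  · have := TreeMonomial.isEmpty_of_isEmpty (S := lieSig) (χ := col X) (c := ())
    have : Subsingleton
      (FreeOp k lieSig (col X) () ⧸ (ideal k).carrier X (col X) ()) := inferInstance
    refine ⟨?_⟩
    rw [Subsingleton.elim (⊤ : Submodule k
      (FreeOp k lieSig (col X) () ⧸ (ideal k).carrier X (col X) ())) ⊥]
    exact Submodule.fg_bot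
  · exact Module.Finite.equiv (leftNormedEquiv k x)

theorem finrank_eq [Fintype X] (x : X) : Module.finrank k
    (FreeOp k lieSig (col X) () ⧸ (ideal k).carrier X (col X) ()) =
      (Fintype.card X - 1).factorial := by
  have := Fintype.ofFinite (LeftNormedMonomial x)
  rw [← (leftNormedEquiv k x).finrank_eq, Module.finrank_finsupp_self,
    ← Nat.card_eq_fintype_card, card_leftNormedMonomial]

end Lie

theorem dTree_exists_leaves_eq {X : Type} {χ : X → Colour} (t : CTree dSig χ .first) :
    ∃ w z, t.leaves = w ++ [z] ∧ χ z = .first ∧ ∀ x ∈ w, χ x = .second := by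
  have h : ∀ {c : Colour} (t : CTree dSig χ c),
      ∃ w z, t.leaves = w ++ [z] ∧ χ z = c ∧ ∀ x ∈ w, χ x = .second := fun t => by
    induction t with
    | leaf x h => exact ⟨[], x, rfl, h, by simp⟩
    | node g h l r ihl ihr =>
      subst h
      obtain ⟨x, hx, rfl⟩ := dTree_second X χ l
      obtain ⟨w, z, h1, h2, h3⟩ := ihr
      exact ⟨x :: w, z, congrArg (x :: ·) h1, h2, List.forall_mem_cons.2 ⟨hx, h3⟩⟩
  exact h t

theorem exists_dTree_leaves_eq {X : Type} {χ : X → Colour} (z : X) (hz : χ z = .first)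
    (w : List X) (hw : ∀ x ∈ w, χ x = .second) :
    ∃ t : CTree dSig χ .first, t.leaves = w ++ [z] := by
  induction w with
  | nil => exact ⟨.leaf z hz, rfl⟩
  | cons x w ih =>
    obtain ⟨hx, hw⟩ := List.forall_mem_cons.1 hw
    obtain ⟨t, ht⟩ := ih hw
    exact ⟨.node DGen.d rfl (.leaf x hx) t, congrArg (x :: ·) ht⟩

/-- The leaves of a right comb end with the only input `y` of the first colour and list the other
inputs before it in any order. -/
theorem card_treeMonomial_d {X : Type} [Fintype X] {χ : X → Colour} (y : X) (hy : χ y = .first)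
    (h : ∀ x, x ≠ y → χ x = .second) :
    Nat.card (TreeMonomial dSig χ .first) = (Fintype.card X - 1).factorial := by
  rw [← card_puncturedWord y]
  have hl : ∀ t : TreeMonomial dSig χ .first, ∃ w : PuncturedWord y,
      t.1.leaves = w.1 ++ [y] := by
    intro t
    obtain ⟨w, z, h1, h2, h3⟩ := dTree_exists_leaves_eq t.1
    obtain rfl : z = y := by
      by_contra hz
      rw [h z hz] at h2
      cases h2
    have ht := t.2
    rw [CTree.IsLinear, h1] at ht
    simp only [List.nodup_append', List.mem_append, List.mem_singleton,
      List.disjoint_singleton] at ht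
    refine ⟨⟨w, ht.1.1, fun x => ⟨?_, fun hx => (ht.2 x).resolve_right hx⟩⟩, h1⟩
    rintro hx rfl
    exact ht.1.2.2 hx
  choose f hf using hl
  refine Nat.card_congr (Equiv.ofBijective f ⟨fun t t' htt => ?_, fun w => ?_⟩)
  · refine Subtype.ext (dTree_leaves_injective ?_)
    rw [hf, hf, htt]
  · obtain ⟨t, ht⟩ := exists_dTree_leaves_eq y hy w.1 fun x hx => h x ((w.2.2 x).1 hx)
    have hlin : t.IsLinear := by
      rw [CTree.IsLinear, ht]
      simp only [List.nodup_append', List.mem_append, List.mem_singleton,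
        List.disjoint_singleton]
      refine ⟨⟨w.2.1, by simp, fun hyw => (w.2.2 y).1 hyw rfl⟩, fun x => ?_⟩
      rw [w.2.2]
      exact (em _).symm
    refine ⟨⟨t, hlin⟩, Subtype.ext ?_⟩
    exact List.append_cancel_right ((hf ⟨t, hlin⟩).symm.trans ht)

namespace MLie

variable (k : Type u) [Field k]

theorem finiteDim : (mlieOperad k).FiniteDim := by
  intro X _ χ c
  cases c with
  | first => exact Module.Finite.equiv (ofDEquiv k χ)
  | second =>
    have := Lie.finiteDimensional k (X := X)
    have := isNoetherian_of_isNoetherianRing_of_finite k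
      (FreeOp k lieSig (Lie.col X) () ⧸ (Lie.ideal k).carrier X (Lie.col X) ())
    exact Module.Finite.of_injective (toLie k χ) (toLie_injective k χ)

theorem finrank_first (m : Colour →₀ ℕ) :
    Module.finrank k ((mlieOperad k).obj (Σ i, Fin (m i)) Sigma.fst .first) =
      if m .first = 1 then (m .second).factorial else 0 := by
  have h1 : Module.finrank k ((mlieOperad k).obj (Σ i, Fin (m i)) Sigma.fst .first) =
      Nat.card (TreeMonomial dSig (Sigma.fst : (Σ i, Fin (m i)) → Colour) .first) := by
    have := Fintype.ofFinite (TreeMonomial dSig (Sigma.fst : (Σ i, Fin (m i)) → Colour) .first)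
    rw [Nat.card_eq_fintype_card, ← Module.finrank_finsupp_self k]
    exact (ofDEquiv k (Sigma.fst : (Σ i, Fin (m i)) → Colour)).symm.finrank_eq
  rw [h1]
  split_ifs with h
  · have hc : Fintype.card (Σ i, Fin (m i)) = m .first + m .second := by
      simp only [Fintype.card_sigma, Fintype.card_fin, colour_sum_eq]
    rw [card_treeMonomial_d ⟨.first, ⟨0, by omega⟩⟩ rfl, hc, h, Nat.add_sub_cancel_left]
    rintro ⟨_ | _, i⟩ hi
    · refine absurd (congrArg (Sigma.mk Colour.first) (Fin.ext ?_)) hi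
      change i.1 = 0
      omega
    · rfl
  · rw [Nat.card_eq_zero]
    refine Or.inl ⟨fun t => h ?_⟩
    obtain ⟨w, ⟨c, a⟩, h1, h2, h3⟩ := dTree_exists_leaves_eq t.1
    obtain rfl : c = .first := h2
    -- All leaves before the last have the second colour, so a tree forces exactly one input of the
    -- first colour.
    have hs : ∀ b : Fin (m .first), b = a := by
      intro b
      have hb := t.2.2 ⟨.first, b⟩
      rw [h1, List.mem_append, List.mem_singleton] at hb
      rcases hb with hb | hb
      · cases h3 _ hb
      · exact eq_of_heq (Sigma.mk.inj hb).2
    have : Fintype.card (Fin (m .first)) = 1 := Fintype.card_eq_one_iff.2 ⟨a, hs⟩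
    rwa [Fintype.card_fin] at this

/-- The condition `m .second ≠ 0` matters: with no inputs the space is zero, while the truncated `(0
- 1).factorial` equals 1. -/
theorem finrank_second (m : Colour →₀ ℕ) :
    Module.finrank k ((mlieOperad k).obj (Σ i, Fin (m i)) Sigma.fst .second) =
      if m .first = 0 ∧ m .second ≠ 0 then (m .second - 1).factorial else 0 := by
  split_ifs with h
  · have hs : ∀ x : Σ i, Fin (m i), x.1 = .second := by
      rintro ⟨_ | _, i⟩
      · have := i.2
        omega
      · rfl
    have hc : Fintype.card (Σ i, Fin (m i)) = m .first + m .second := by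
      simp only [Fintype.card_sigma, Fintype.card_fin, colour_sum_eq]
    have h1 := (LinearEquiv.ofBijective (toLie k (Sigma.fst : (Σ i, Fin (m i)) → Colour))
      ⟨toLie_injective k _, toLie_surjective k hs⟩).finrank_eq
    refine h1.trans ?_
    rw [Lie.finrank_eq k (X := Σ i, Fin (m i)) ⟨.second, ⟨0, Nat.pos_of_ne_zero h.2⟩⟩, hc, h.1,
      zero_add]
  · have hE : IsEmpty (TreeMonomial mlieSig (Sigma.fst : (Σ i, Fin (m i)) → Colour) .second) := by
      by_cases h1 : m .first = 0
      · have : IsEmpty (Σ i, Fin (m i)) := by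
          refine ⟨?_⟩
          rintro ⟨_ | _, i⟩
          · have := i.2
            omega
          · have := i.2
            omega
        exact TreeMonomial.isEmpty_of_isEmpty
      · refine isEmpty_treeMonomial_second fun hs => ?_
        cases hs ⟨.first, ⟨0, Nat.pos_of_ne_zero h1⟩⟩
    have : Subsingleton (FreeOp k mlieSig (Sigma.fst : (Σ i, Fin (m i)) → Colour) .second ⧸
        (ideal k).carrier (Σ i, Fin (m i)) Sigma.fst .second) := inferInstance
    exact Module.finrank_zero_of_subsingleton
      (M := FreeOp k mlieSig (Sigma.fst : (Σ i, Fin (m i)) → Colour) .second ⧸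
        (ideal k).carrier (Σ i, Fin (m i)) Sigma.fst .second)

/-! ### Generating series -/

theorem coeff_genSeries_first (m : Colour →₀ ℕ) :
    MvPowerSeries.coeff m ((mlieOperad k).genSeries .first) = if m .first = 1 then 1 else 0 := by
  change (Module.finrank k ((mlieOperad k).obj (Σ i, Fin (m i)) Sigma.fst .first) : ℚ) /
    ∏ i, ((m i).factorial : ℚ) = _
  rw [finrank_first, colour_prod_eq]
  split_ifs with h
  · have : ((m .second).factorial : ℚ) ≠ 0 := by positivity
    simp [h, this]
  · simp

theorem coeff_genSeries_second (m : Colour →₀ ℕ) :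
    MvPowerSeries.coeff m ((mlieOperad k).genSeries .second) =
      if m .first = 0 ∧ m .second ≠ 0 then 1 / (m .second : ℚ) else 0 := by
  change (Module.finrank k ((mlieOperad k).obj (Σ i, Fin (m i)) Sigma.fst .second) : ℚ) /
    ∏ i, ((m i).factorial : ℚ) = _
  rw [finrank_second, colour_prod_eq]
  split_ifs with h
  · obtain ⟨n, hn⟩ := Nat.exists_eq_succ_of_ne_zero h.2
    have : (n.factorial : ℚ) ≠ 0 := by positivity
    rw [hn, h.1, Nat.succ_sub_one, Nat.factorial_succ]
    push_cast
    field_simp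
    simp
  · simp

theorem genSeries_first : (mlieOperad k).genSeries .first
    = MvPowerSeries.X .first * (1 - MvPowerSeries.X .second)⁻¹ := by
  -- After multiplication by 1 - t₂, the coefficients telescope and only that of t₁ remains.
  rw [MvPowerSeries.eq_mul_inv_iff_mul_eq (by simp)]
  ext m
  rw [mul_sub, mul_one, map_sub, coeff_genSeries_first, MvPowerSeries.X_def,
    MvPowerSeries.coeff_mul_monomial, coeff_genSeries_first, MvPowerSeries.coeff_X]
  have h1 : Finsupp.single Colour.second 1 ≤ m ↔ m .second ≠ 0 := by
    rw [Finsupp.single_le_iff, Nat.one_le_iff_ne_zero]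
  have h2 : m = Finsupp.single Colour.first 1 ↔ m .first = 1 ∧ m .second = 0 := by
    rw [colour_finsupp_ext_iff]
    simp
  have h3 : (m - Finsupp.single Colour.second 1 : Colour →₀ ℕ) .first = m .first := by simp
  simp only [h1, h2, h3]
  by_cases ha : m .first = 1 <;> by_cases hb : m .second = 0 <;> simp [ha, hb]

theorem genSeries_second : (mlieOperad k).genSeries .second
    = -(PowerSeries.log ℚ).subst (-MvPowerSeries.X .second : MvPowerSeries Colour ℚ) := by
  ext m
  have hX : PowerSeries.HasSubst (-MvPowerSeries.X .second : MvPowerSeries Colour ℚ) :=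
    PowerSeries.HasSubst.of_constantCoeff_zero (by simp)
  have hc : ∀ d : ℕ, MvPowerSeries.coeff m ((-MvPowerSeries.X .second : MvPowerSeries Colour ℚ) ^ d)
      = if m .first = 0 ∧ m .second = d then (-1) ^ d else 0 := by
    intro d
    rw [neg_pow, show ((-1) ^ d : MvPowerSeries Colour ℚ) = MvPowerSeries.C ((-1) ^ d) by simp,
      MvPowerSeries.coeff_C_mul, MvPowerSeries.coeff_X_pow]
    have : m = Finsupp.single Colour.second d ↔ m .first = 0 ∧ m .second = d := by
      rw [colour_finsupp_ext_iff]
      simp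
    simp [this]
  rw [coeff_genSeries_second, map_neg, PowerSeries.coeff_subst hX,
    finsum_eq_single _ (m .second) (fun d hd => by rw [hc, if_neg fun h => hd h.2.symm, smul_zero]),
    hc, PowerSeries.coeff_log]
  by_cases ha : m .first = 0 <;> by_cases hb : m .second = 0
  · simp [hb]
  · have hs : ((-1 : ℚ) ^ m .second) * (-1) ^ m .second = 1 := by
      rw [← mul_pow]
      simp
    simp only [ha, hb, ne_eq, not_false_eq_true, and_self, if_true, if_false,
      Algebra.algebraMap_self, RingHom.id_apply, smul_eq_mul]
    rw [pow_succ, div_mul_eq_mul_div, mul_right_comm, hs]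
    ring
  · simp [ha]
  · simp [ha]

end MLie

end ColOp

theorem mainTheorem8 (k : Type u) [Field k] [CharZero k] :
    Nonempty ((ColOp.mlieOperad k).Iso
      (ColOp.pairCollection (ColOp.freeD k) (ColOp.lieOperad k))) ∧
    (ColOp.mlieOperad k).FiniteDim ∧
    (ColOp.mlieOperad k).genSeries .first
      = MvPowerSeries.X .first * (1 - MvPowerSeries.X .second)⁻¹ ∧
    (ColOp.mlieOperad k).genSeries .second
      = -(PowerSeries.log ℚ).subst (-MvPowerSeries.X .second : MvPowerSeries ColOp.Colour ℚ) :=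
  ⟨⟨ColOp.MLie.iso k⟩, ColOp.MLie.finiteDim k, ColOp.MLie.genSeries_first k,
    ColOp.MLie.genSeries_second k⟩
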